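/- Let $n,D\in\mathbb N$ and consider the linear Gaussian system $$x_{t+1}=Ax_t+w_t,\qquad y_t=Cx_t+v_t,\qquad t\in\mathbb Z,$$ with $x_t,w_t\in\mathbb R^n$, $y_t,v_t\in\mathbb R^D$, $w_t\sim\mathcal N(0,Q)$, $v_t\sim\mathcal N(0,R)$, where the random vectors $w_t,v_t$ ($t\in\mathbb Z$) are mutually independent. The system is in steady state: $x_t\sim\mathcal N(0,P)$ for all $t$, with $P=APA^\top+Q$. Let $\Psi\succeq 0$ solve $$\Psi=A\Psi A^\top-A\Psi C^\top(C\Psi C^\top+R)^{-1}C\Psi A^\top+Q ,$$ let $\Gamma=C\Psi C^\top+R$ be positive definite and $K=A\Psi C^\top\Gamma^{-1}$. A receiver gets a signal $z_t\in\mathbb R^D$, runs the Kalman filter $$\hat x_{t+1|t}=A\hat x_{t|t-1}+K(z_t-C\hat x_{t|t-1}),$$ and computes the normalized prediction error $\check z_t=\Gamma^{-1/2}(z_t-C\hat x_{t|t-1})$. Under $z=y$ the filter is in steady state, i.e. for all $t$, $x_t-\hat x_{t|t-1}\sim\mathcal N(0,\Psi)$ and $(x_t,\hat x_{t|t-1})$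 is independent of $(w_s,v_s)_{s\ge t}$. The statistics are called nominal if the joint law of $(z_t,\hat x_{t|t-1})_{t\in\mathbb Z}$ is the one that occurs when $z=y$. Let $L,I\in\mathbb N$, $\rho_1,\dots,\rho_I\in\mathbb R^{LD}$, $\check\zeta_t=[\check z_t^\top,\dots,\check z_{t+L-1}^\top]^\top$, and let $\xi_t\in\{0,1\}^I$ have entries $[\xi_t]_i=1$ if $\check\zeta_t\preceq\rho_i$ (entrywise) and $[\xi_t]_i=0$ otherwise. Put $$u_{t,T}=\frac1T\sum_{s=t-T+1}^{t}\xi_s,\qquad [u_\star]_i=\Phi_{0,\mathbf I}(\rho_i),$$ where $\Phi_{0,\mathbf I}$ is the CDF of the standard normal law on $\mathbb R^{LD}$, and $$\Sigma=\sum_{\tau\in\mathbb Z}\Sigma(\tau),\qquad \Sigma(\tau)=\bar{\mathcal E}_\star\{(\xi_\tau-u_\star)(\xi_0-u_\star)^\top\}.$$ Here $\bar{\mathcal E}_\star$ is the mean with respect to the stationary distribution of $\check z$ under nominal statistics, i.e. $\bar p_\star(S)=\lim_{T\to\infty}\frac1T\sum_{t=1}^{T}p_\star(q^t\check z\in S)$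 for all measurable $S$, where $p_\star$ is the nominal probability law and $(q^tx)_s=x_{s+t}$. Assume that $\Sigma$ is invertible, and let $$v_{t,T}=T\,(u_{t,T}-u_\star)^\top\Sigma^{-1}(u_{t,T}-u_\star).$$ Under nominal statistics, for every $t\in\mathbb Z$, $v_{t,T}$ converges in distribution, as $T\to\infty$, to the chi-squared distribution $\chi^2(I)$ with $I$ degrees of freedom. -/

import Mathlib

open MeasureTheory ProbabilityTheory Filter Topology Matrix
open scoped MatrixOrder ENNReal

namespace AttackDetection

/-! ### Normal and chi-squared distributions -/

/-- The normal distribution `N(m, S)` on `ℝ^ι`. -/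
noncomputable def normalLaw {ι : Type*} [Fintype ι] [DecidableEq ι] (m : ι → ℝ)
    (S : Matrix ι ι ℝ) : Measure (ι → ℝ) :=
  (multivariateGaussian (WithLp.toLp 2 m) S).map WithLp.ofLp

/-- The cumulative distribution function `Φ_{m,S}` of `N(m, S)`; the order on `ι → ℝ` is the
entrywise one, so `Set.Iic r` is the set of all `x ⪯ r`. -/
noncomputable def normalCDF {ι : Type*} [Fintype ι] [DecidableEq ι] (m : ι → ℝ)
    (S : Matrix ι ι ℝ) (r : ι → ℝ) : ℝ :=
  (normalLaw m S).real (Set.Iic r)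

/-- The chi-squared distribution with `k` degrees of freedom: the law of the sum of the squares
of `k` independent standard normal variables. -/
noncomputable def chiSquared (k : ℕ) : Measure ℝ :=
  (Measure.pi (fun _ : Fin k => gaussianReal 0 1)).map (fun x => ∑ i, x i ^ 2)

instance isProbabilityMeasure_chiSquared (k : ℕ) : IsProbabilityMeasure (chiSquared k) :=
  Measure.isProbabilityMeasure_map (Measurable.aemeasurable (by fun_prop))

/-! ### Stationary distribution of a process indexed by `ℤ` -/

/-- The `t`-th power `q ^ t` of the forward shift. -/
def shift {E : Type*} (t : ℤ) (x : ℤ → E) : ℤ → E := fun s => x (s + t)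

/-- `pbar` is the stationary distribution of a process with distribution `p`:
`pbar S = lim_T (1/T) ∑_{t=1}^T p (q^t x ∈ S)` for every measurable `S`. -/
def IsStationaryLaw {E : Type*} [MeasurableSpace E] (p pbar : Measure (ℤ → E)) : Prop :=
  ∀ S : Set (ℤ → E), MeasurableSet S →
    Tendsto (fun T : ℕ => (T : ℝ≥0∞)⁻¹ * ∑ t ∈ Finset.Icc 1 T, p {x | shift (t : ℤ) x ∈ S})
      atTop (𝓝 (pbar S))

open Classical in
/-- The stationary distribution associated with `p` (it is unique when it exists, that is, when
the process is asymptotically mean stationary). -/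
noncomputable def stationaryLaw {E : Type*} [MeasurableSpace E] (p : Measure (ℤ → E)) :
    Measure (ℤ → E) :=
  if h : ∃ pbar, IsStationaryLaw p pbar then h.choose else 0

/-- The stationary mean of `f x`, for a process `x` with distribution `p`. -/
noncomputable def stationaryMean {E : Type*} [MeasurableSpace E] (p : Measure (ℤ → E))
    (f : (ℤ → E) → ℝ) : ℝ :=
  ∫ x, f x ∂(stationaryLaw p)

/-! ### The linear Gaussian system and its Kalman filter -/

/-- Parameters of the system `x_{t+1} = A x_t + w_t`, `y_t = C x_t + v_t`, with noise covariances
`Q` and `R`, steady-state covariance `P` of the state, and a solution `Ψ` of the Riccati equation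
for which the covariance `C Ψ Cᵀ + R` of the prediction error is invertible. -/
structure Model (n D : ℕ) where
  A : Matrix (Fin n) (Fin n) ℝ
  C : Matrix (Fin D) (Fin n) ℝ
  Q : Matrix (Fin n) (Fin n) ℝ
  R : Matrix (Fin D) (Fin D) ℝ
  P : Matrix (Fin n) (Fin n) ℝ
  Ψ : Matrix (Fin n) (Fin n) ℝ
  posSemidef_Q : Q.PosSemidef
  posSemidef_R : R.PosSemidef
  posSemidef_P : P.PosSemidef
  posSemidef_Ψ : Ψ.PosSemidef
  lyapunov : P = A * P * Aᵀ + Q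
  posDef_Γ : (C * Ψ * Cᵀ + R).PosDef
  riccati : Ψ = A * Ψ * Aᵀ - A * Ψ * Cᵀ * (C * Ψ * Cᵀ + R)⁻¹ * C * Ψ * Aᵀ + Q

namespace Model

variable {n D : ℕ} (M : Model n D)

/-- `Γ = C Ψ Cᵀ + R`. -/
noncomputable def Γ : Matrix (Fin D) (Fin D) ℝ := M.C * M.Ψ * M.Cᵀ + M.R

/-- The steady-state Kalman gain `K = A Ψ Cᵀ (C Ψ Cᵀ + R)⁻¹`. -/
noncomputable def K : Matrix (Fin n) (Fin D) ℝ :=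
  M.A * M.Ψ * M.Cᵀ * (M.C * M.Ψ * M.Cᵀ + M.R)⁻¹

/-- The normalized prediction error `Γ^{-1/2} (z_t - C x̂_{t|t-1})`, for the measurement `z_t`
and the filter state `x̂_{t|t-1}`. -/
noncomputable def normError (z : Fin D → ℝ) (xhat : Fin n → ℝ) : Fin D → ℝ :=
  (CFC.sqrt M.Γ)⁻¹ *ᵥ (z - M.C *ᵥ xhat)

variable {Ω : Type*} [MeasurableSpace Ω]

/-- `xhat t` (standing for `x̂_{t|t-1}`) is the state of the Kalman filter fed with `z`. -/
def IsFilter (μ : Measure Ω) (z : ℤ → Ω → Fin D → ℝ) (xhat : ℤ → Ω → Fin n → ℝ) : Prop :=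
  ∀ t : ℤ, ∀ᵐ ω ∂μ,
    xhat (t + 1) ω = M.A *ᵥ xhat t ω + M.K *ᵥ (z t ω - M.C *ᵥ xhat t ω)

/-- The system in steady state, together with the steady-state Kalman filter fed with its output
`y`. The noises `w`, `v` are white, Gaussian and independent of each other; at every time the
state and the filter state are independent of the present and future noises (the filter state
`x̂_{t|t-1}` is built from measurements made before `t`); the state has covariance `P` and the
state prediction error `x_t - x̂_{t|t-1}` has covariance `Ψ`. -/
structure IsSteadyState (μ : Measure Ω) (x w : ℤ → Ω → Fin n → ℝ) (v y : ℤ → Ω → Fin D → ℝ)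
    (xhat : ℤ → Ω → Fin n → ℝ) : Prop where
  law_w : ∀ t, HasLaw (w t) (normalLaw 0 M.Q) μ
  law_v : ∀ t, HasLaw (v t) (normalLaw 0 M.R) μ
  indep_wv : ∀ t, IndepFun (w t) (v t) μ
  indep_noise : iIndepFun (fun (t : ℤ) ω => (w t ω, v t ω)) μ
  state : ∀ t, ∀ᵐ ω ∂μ, x (t + 1) ω = M.A *ᵥ x t ω + w t ω
  output : ∀ t, ∀ᵐ ω ∂μ, y t ω = M.C *ᵥ x t ω + v t ω
  law_x : ∀ t, HasLaw (x t) (normalLaw 0 M.P) μ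
  aemeasurable_xhat : ∀ t, AEMeasurable (xhat t) μ
  isFilter : M.IsFilter μ y xhat
  indep_future : ∀ t, IndepFun (fun ω => (x t ω, xhat t ω))
    (fun ω (s : {s : ℤ // t ≤ s}) => (w s ω, v s ω)) μ
  law_error : ∀ t, HasLaw (fun ω => x t ω - xhat t ω) (normalLaw 0 M.Ψ) μ

/-- The statistics of the received signal `z` and of the filter state `xhat` that it drives are
nominal: they equal those of the system output `y` and of the filter state `xhat₀` driven by
`y`, that is, those which occur when `z = y`. -/
def IsNominal {Ω₀ : Type*} [MeasurableSpace Ω₀] (μ₀ : Measure Ω₀) (y : ℤ → Ω₀ → Fin D → ℝ)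
    (xhat₀ : ℤ → Ω₀ → Fin n → ℝ) (μ : Measure Ω) (z : ℤ → Ω → Fin D → ℝ)
    (xhat : ℤ → Ω → Fin n → ℝ) : Prop :=
  IdentDistrib (fun ω (t : ℤ) => (z t ω, xhat t ω)) (fun ω (t : ℤ) => (y t ω, xhat₀ t ω)) μ μ₀

/-- The process of normalized prediction errors. -/
noncomputable def errorPath (z : ℤ → Ω → Fin D → ℝ) (xhat : ℤ → Ω → Fin n → ℝ) (ω : Ω) :
    ℤ → Fin D → ℝ :=
  fun t => M.normError (z t ω) (xhat t ω)

end Model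

/-! ### The test statistic

Below `e : ℤ → Fin D → ℝ` is a trajectory of the normalized prediction error, and
`ρ : Fin I → Fin L × Fin D → ℝ` are the sample points. -/

section Statistic

variable {D L I : ℕ}

/-- The block `[e_t, …, e_{t+L-1}]`, a vector of length `L D`. -/
def block (L : ℕ) (e : ℤ → Fin D → ℝ) (t : ℤ) : Fin L × Fin D → ℝ :=
  fun k => e (t + (k.1 : ℕ)) k.2

open Classical in
/-- The indicator of `block L e t ⪯ r`. -/
noncomputable def blockInd (r : Fin L × Fin D → ℝ) (e : ℤ → Fin D → ℝ) (t : ℤ) : ℝ :=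
  if block L e t ≤ r then 1 else 0

/-- The empirical distribution function of the blocks started in the window `t-T+1, …, t`. -/
noncomputable def empiricalCDF (e : ℤ → Fin D → ℝ) (t : ℤ) (T : ℕ) (r : Fin L × Fin D → ℝ) : ℝ :=
  (1 / (T : ℝ)) * ∑ s ∈ Finset.Icc (t - T + 1) t, blockInd r e s

/-- `u_{t,T}`: the empirical distribution function at the sample points. -/
noncomputable def uEmp (ρ : Fin I → Fin L × Fin D → ℝ) (e : ℤ → Fin D → ℝ) (t : ℤ) (T : ℕ) :
    Fin I → ℝ :=
  fun i => empiricalCDF e t T (ρ i)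

/-- `u_⋆`: the standard normal distribution function at the sample points. -/
noncomputable def uStar (ρ : Fin I → Fin L × Fin D → ℝ) : Fin I → ℝ :=
  fun i => normalCDF 0 1 (ρ i)

/-- `ξ_t`. -/
noncomputable def xi (ρ : Fin I → Fin L × Fin D → ℝ) (e : ℤ → Fin D → ℝ) (t : ℤ) : Fin I → ℝ :=
  fun i => blockInd (ρ i) e t

/-- `Σ(τ)`: the stationary mean of `(ξ_τ - u_⋆) (ξ_0 - u_⋆)ᵀ`, when the prediction error process
has distribution `p`. -/
noncomputable def lagCov (p : Measure (ℤ → Fin D → ℝ)) (ρ : Fin I → Fin L × Fin D → ℝ) (τ : ℤ) :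
    Matrix (Fin I) (Fin I) ℝ :=
  Matrix.of fun i j =>
    stationaryMean p fun e => (xi ρ e τ i - uStar ρ i) * (xi ρ e 0 j - uStar ρ j)

/-- `Σ = ∑_{τ ∈ ℤ} Σ(τ)`. -/
noncomputable def longRunCov (p : Measure (ℤ → Fin D → ℝ)) (ρ : Fin I → Fin L × Fin D → ℝ) :
    Matrix (Fin I) (Fin I) ℝ :=
  Matrix.of fun i j => ∑' τ : ℤ, lagCov p ρ τ i j

/-- `v_{t,T} = T (u_{t,T} - u_⋆)ᵀ S⁻¹ (u_{t,T} - u_⋆)`. -/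
noncomputable def vStat (S : Matrix (Fin I) (Fin I) ℝ) (ρ : Fin I → Fin L × Fin D → ℝ)
    (e : ℤ → Fin D → ℝ) (t : ℤ) (T : ℕ) : ℝ :=
  (T : ℝ) * ((uEmp ρ e t T - uStar ρ) ⬝ᵥ (S⁻¹ *ᵥ (uEmp ρ e t T - uStar ρ)))

end Statistic

end AttackDetection

open AttackDetection

/-! Under nominal statistics the normalized prediction errors are white noise, so the statistic is a
quadratic form in a normalized sum of bounded, stationary, finitely dependent vectors, and a central
limit theorem applies.

Whiteness: the state prediction error obeys an autonomous linear recursion driven by the noises, and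
the Kalman gain is exactly the one for which the innovation at time t is uncorrelated with the state
prediction error at time t + 1. Both are linear in independent Gaussian vectors, so they are
independent (`indepFun_innovation`). An induction then makes each innovation independent of the
preceding ones (`indepFun_past_error`). The factor Γ^{-1/2} turns their covariance into the identity
(`map_errorPath`).

Central limit theorem: `ξ_t` reads only L consecutive errors, so every linear combination of the
centered indicators is bounded, stationary and L-dependent. Bernstein's method of big blocks
separated by gaps of length L reduces such sums to the independent case (`tendsto_integral_exp`).
The limiting variance in direction a is aᵀΣa, because the variance of the partial sums grows
linearly with exactly this slope (`integral_sq_sum_add`, `longRunVar_eq_dotProduct`).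

Conclusion: Cramér–Wold gives convergence of the vector sums to N(0, Σ). The continuous mapping x ↦
xᵀΣ⁻¹x sends N(0, Σ) to χ²(I). The moving window is handled by the shift invariance of white noise.
-/

namespace AttackDetection

/-! ### Independence -/

section Independence

variable {Ω : Type*} [MeasurableSpace Ω] {μ : Measure Ω}

/-- If `f` is independent of `(g, h)` and `g` of `h`, then `(f, g)` is independent of `h`. -/
lemma indepFun_prodMk_left_of_right [IsProbabilityMeasure μ] {α β γ : Type*} [MeasurableSpace α]
    [MeasurableSpace β] [MeasurableSpace γ] {f : Ω → α} {g : Ω → β} {h : Ω → γ}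
    (hf : AEMeasurable f μ) (hg : AEMeasurable g μ) (hh : AEMeasurable h μ)
    (h1 : IndepFun f (fun ω => (g ω, h ω)) μ) (h2 : IndepFun g h μ) :
    IndepFun (fun ω => (f ω, g ω)) h μ := by
  have h3 : IndepFun f g μ := h1.comp measurable_id measurable_fst
  rw [indepFun_iff_map_prod_eq_prod_map_map (by fun_prop) (by fun_prop)] at h1 h2 h3 ⊢
  have := Measure.isProbabilityMeasure_map hf
  have := Measure.isProbabilityMeasure_map hg
  have := Measure.isProbabilityMeasure_map hh
  have e : (fun ω => ((f ω, g ω), h ω))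
      = MeasurableEquiv.prodAssoc.symm ∘ (fun ω => (f ω, (g ω, h ω))) := rfl
  rw [e, ← AEMeasurable.map_map_of_aemeasurable (by fun_prop) (by fun_prop), h1, h2, h3]
  exact (Measure.prodAssoc_prod (μ := μ.map f) (ν := μ.map g) (τ := μ.map h)) ▸
    (by rw [MeasurableEquiv.map_symm_map] )

/-- If `(f, g)` is independent of `h` and `f` of `g`, then `f` is independent of `(g, h)`. -/
lemma indepFun_prodMk_right_of_left [IsProbabilityMeasure μ] {α β γ : Type*} [MeasurableSpace α]
    [MeasurableSpace β] [MeasurableSpace γ] {f : Ω → α} {g : Ω → β} {h : Ω → γ}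
    (hf : AEMeasurable f μ) (hg : AEMeasurable g μ) (hh : AEMeasurable h μ)
    (h1 : IndepFun (fun ω => (f ω, g ω)) h μ) (h2 : IndepFun f g μ) :
    IndepFun f (fun ω => (g ω, h ω)) μ := by
  have key := indepFun_prodMk_left_of_right hh hg hf
    (h1.symm.comp measurable_id measurable_swap) h2.symm
  exact (key.comp measurable_swap measurable_id).symm

lemma indepFun_fin_zero [IsProbabilityMeasure μ] {E F : Type*} [MeasurableSpace E]
    [MeasurableSpace F] (X : Fin 0 → Ω → E) (g : Ω → F) :
    IndepFun (fun ω (i : Fin 0) => X i ω) g μ := by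
  have e : (fun ω (i : Fin 0) => X i ω) = fun _ => Fin.elim0 := by
    ext1 ω
    exact Subsingleton.elim _ _
  rw [e]
  exact indepFun_const_left _ _

/-- A sequence is independent if each term is independent of the preceding ones. -/
lemma iIndepFun_of_indepFun_past [IsProbabilityMeasure μ] {E : Type*} [MeasurableSpace E]
    {X : ℕ → Ω → E} (h : ∀ k, IndepFun (fun ω (i : Fin k) => X i ω) (X k) μ) : iIndepFun X μ := by
  have key : ∀ (s : ℕ → Set E), (∀ i, MeasurableSet (s i)) → ∀ n,
      μ (⋂ i ∈ Finset.range n, X i ⁻¹' s i) = ∏ i ∈ Finset.range n, μ (X i ⁻¹' s i) := by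
    intro s hs n
    induction n with
    | zero => simp
    | succ n ih =>
      have e : (⋂ i ∈ Finset.range n, X i ⁻¹' s i)
          = (fun ω (i : Fin n) => X i ω) ⁻¹' (Set.univ.pi fun i => s i) := by
        ext ω
        simp only [Finset.mem_range, Set.mem_iInter, Set.mem_preimage, Set.mem_pi, Set.mem_univ,
          forall_const]
        exact ⟨fun h i => h i i.2, fun h i hi => h ⟨i, hi⟩⟩
      rw [Finset.prod_range_succ, ← ih, e,
        ← (h n).measure_inter_preimage_eq_mul _ _ (.univ_pi fun i => hs i) (hs n), ← e,
        Finset.range_add_one, Finset.set_biInter_insert, Set.inter_comm]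
  rw [iIndepFun_iff_measure_inter_preimage_eq_mul]
  intro S sets hS
  classical
  -- Filling the missing indices with the whole space turns a finite index set into an initial
  -- segment and changes neither the intersection nor the product.
  let s : ℕ → Set E := fun i => if i ∈ S then sets i else Set.univ
  have hs : ∀ i, MeasurableSet (s i) := by
    intro i
    by_cases hi : i ∈ S
    · simpa [s, hi] using hS i hi
    · simp [s, hi]
  obtain ⟨n, hn⟩ : ∃ n, S ⊆ Finset.range n := S.exists_nat_subset_range
  have := key s hs n
  rw [← Finset.prod_subset hn (fun i _ hi => by simp [s, hi])] at this
  rw [Finset.prod_congr rfl (fun i hi => by simp [s, hi] :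
    ∀ i ∈ S, μ (X i ⁻¹' s i) = μ (X i ⁻¹' sets i))] at this
  rw [← this]
  congr 1
  ext ω
  simp only [Set.mem_iInter, Set.mem_preimage, s]
  constructor
  · intro h i _
    split_ifs with hi
    · exact h i hi
    · trivial
  · intro h i hi
    simpa [hi] using h i (hn hi)

/-- Disjoint, possibly infinite, subfamilies of an independent family are independent. -/
lemma indepFun_of_disjoint {ι E : Type*} [MeasurableSpace E] {X : ι → Ω → E} (hX : iIndepFun X μ)
    (hm : ∀ i, AEMeasurable (X i) μ) {S T : Set ι} (hST : Disjoint S T) :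
    IndepFun (fun ω (i : S) => X i ω) (fun ω (i : T) => X i ω) μ := by
  classical
  have := hX.isProbabilityMeasure
  refine IndepFun.process_indepFun_process₀ (X := fun i : S => X i) (Y := fun i : T => X i)
    (fun i => hm i) (fun i => hm i) fun I J => ?_
  have hd : Disjoint (I.image Subtype.val) (J.image Subtype.val) := by
    rw [Finset.disjoint_left]
    intro a ha hb
    obtain ⟨i, _, rfl⟩ := Finset.mem_image.1 ha
    obtain ⟨j, _, hj⟩ := Finset.mem_image.1 hb
    exact Set.disjoint_left.1 hST i.2 (hj ▸ j.2)
  exact (hX.indepFun_finset₀ _ _ hd hm).comp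
    (φ := fun x (i : I) => x ⟨i.1, Finset.mem_image_of_mem _ i.2⟩)
    (ψ := fun x (j : J) => x ⟨j.1, Finset.mem_image_of_mem _ j.2⟩) (by fun_prop) (by fun_prop)

/-- A family indexed by `ℤ` is independent if all its one-sided subsequences are. -/
lemma iIndepFun_int {E : Type*} [MeasurableSpace E] {X : ℤ → Ω → E}
    (h : ∀ t : ℤ, iIndepFun (fun k : ℕ => X (t + k)) μ) : iIndepFun X μ := by
  rw [iIndepFun_iff_finset]
  intro s
  obtain ⟨t, ht⟩ : ∃ t : ℤ, ∀ i ∈ s, t ≤ i := by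
    obtain ⟨t, ht⟩ := s.bddBelow
    exact ⟨t, fun i hi => ht hi⟩
  have hinj : Function.Injective (fun i : s => (i.1 - t).toNat) := by
    intro i j hij
    have hi := ht i.1 i.2
    have hj := ht j.1 j.2
    ext
    simp only at hij
    omega
  have h2 := (h t).precomp hinj
  have e : (fun i : s => X (t + ((i.1 - t).toNat : ℕ))) = s.restrict X := by
    ext1 i
    have hi := ht i.1 i.2
    simp only [Finset.restrict]
    congr 1
    omega
  rw [← e]
  exact h2

end Independence

/-! ### Gaussian vectors -/

section Gaussian

variable {Ω : Type*} [MeasurableSpace Ω] {μ : Measure Ω} {ι κ : Type*} [Fintype ι] [DecidableEq ι]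
  [Fintype κ] [DecidableEq κ]

instance isGaussian_normalLaw (m : ι → ℝ) (S : Matrix ι ι ℝ) : IsGaussian (normalLaw m S) := by
  have : (WithLp.ofLp : EuclideanSpace ℝ ι → ι → ℝ) = EuclideanSpace.equiv ι ℝ := rfl
  rw [normalLaw, this]
  infer_instance

lemma covariance_dotProduct_of_hasLaw {Z : Ω → ι → ℝ} {m : ι → ℝ} {S : Matrix ι ι ℝ}
    (hS : S.PosSemidef) (hZ : HasLaw Z (normalLaw m S) μ) (a b : ι → ℝ) :
    cov[fun ω => a ⬝ᵥ Z ω, fun ω => b ⬝ᵥ Z ω; μ] = a ⬝ᵥ S *ᵥ b := by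
  rw [hZ.covariance_fun_comp (f := fun z => a ⬝ᵥ z) (g := fun z => b ⬝ᵥ z) (by fun_prop)
    (by fun_prop), normalLaw, covariance_map (by fun_prop) (by fun_prop) (by fun_prop)]
  have := covarianceBilin_multivariateGaussian (μ := WithLp.toLp 2 m) hS (WithLp.toLp 2 a)
    (WithLp.toLp 2 b)
  rw [covarianceBilin_apply_eq_cov IsGaussian.memLp_two_id] at this
  rw [← this]
  congr 1 <;> ext z <;> simp [PiLp.inner_apply, dotProduct, mul_comm]

/-- Characteristic functions need an inner product, hence `EuclideanSpace`; this is the passage back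
to dot products on `ι → ℝ`. -/
lemma charFun_ofLp_eq {ι : Type*} [Fintype ι] {Z : Ω → ι → ℝ} (hZ : AEMeasurable Z μ)
    (a : EuclideanSpace ℝ ι) :
    charFun (μ.map fun ω => WithLp.toLp 2 (Z ω)) a
      = ∫ ω, Complex.exp ((a.ofLp ⬝ᵥ Z ω : ℝ) * Complex.I) ∂μ := by
  rw [charFun_apply, integral_map (by fun_prop) (by fun_prop)]
  congr with ω

lemma integral_exp_of_hasLaw {Z : Ω → ι → ℝ} {S : Matrix ι ι ℝ}
    (hS : S.PosSemidef) (hZ : HasLaw Z (normalLaw 0 S) μ) (a : ι → ℝ) :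
    ∫ ω, Complex.exp ((a ⬝ᵥ Z ω : ℝ) * Complex.I) ∂μ = Complex.exp (-(a ⬝ᵥ S *ᵥ a : ℝ) / 2) := by
  have h := charFun_ofLp_eq hZ.aemeasurable (WithLp.toLp 2 a)
  have e : (fun ω => WithLp.toLp 2 (Z ω)) = WithLp.toLp 2 ∘ Z := rfl
  rw [e, ← AEMeasurable.map_map_of_aemeasurable (by fun_prop) hZ.aemeasurable, hZ.map_eq, normalLaw,
    Measure.map_map (by fun_prop) (by fun_prop)] at h
  have e' : (WithLp.toLp 2 ∘ WithLp.ofLp : EuclideanSpace ℝ ι → EuclideanSpace ℝ ι) = id := rfl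
  rw [e', Measure.map_id, charFun_multivariateGaussian hS] at h
  rw [← h]
  simp [neg_div]

lemma hasLaw_normalLaw_of_integral_exp [IsProbabilityMeasure μ] {Z : Ω → ι → ℝ} {S : Matrix ι ι ℝ}
    (hS : S.PosSemidef) (hZ : AEMeasurable Z μ)
    (h : ∀ a : ι → ℝ, ∫ ω, Complex.exp ((a ⬝ᵥ Z ω : ℝ) * Complex.I) ∂μ
      = Complex.exp (-(a ⬝ᵥ S *ᵥ a : ℝ) / 2)) : HasLaw Z (normalLaw 0 S) μ := by
  refine ⟨hZ, ?_⟩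
  have key : μ.map (fun ω => WithLp.toLp 2 (Z ω)) = multivariateGaussian 0 S := by
    have : IsProbabilityMeasure (μ.map fun ω => WithLp.toLp 2 (Z ω)) :=
      Measure.isProbabilityMeasure_map (by fun_prop)
    refine Measure.ext_of_charFun ?_
    ext a
    rw [charFun_ofLp_eq hZ, h, charFun_multivariateGaussian hS]
    simp [neg_div]
  rw [normalLaw, WithLp.toLp_zero, ← key,
    AEMeasurable.map_map_of_aemeasurable (by fun_prop) (by fun_prop)]
  rfl

/-- The sum of linear images of two independent centered Gaussian vectors. -/
lemma hasLaw_add_of_indepFun [IsProbabilityMeasure μ] {D : ℕ} {e : Ω → ι → ℝ} {v : Ω → κ → ℝ}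
    {S : Matrix ι ι ℝ} {R : Matrix κ κ ℝ} (hS : S.PosSemidef) (hR : R.PosSemidef)
    (he : HasLaw e (normalLaw 0 S) μ) (hv : HasLaw v (normalLaw 0 R) μ) (hev : IndepFun e v μ)
    (F : Matrix (Fin D) ι ℝ) (G : Matrix (Fin D) κ ℝ) :
    HasLaw (fun ω => F *ᵥ e ω + G *ᵥ v ω) (normalLaw 0 (F * S * Fᵀ + G * R * Gᵀ)) μ := by
  have h1 : (F * S * Fᵀ).PosSemidef := by simpa using hS.mul_mul_conjTranspose_same F
  have h2 : (G * R * Gᵀ).PosSemidef := by simpa using hR.mul_mul_conjTranspose_same G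
  have hme := he.aemeasurable
  have hmv := hv.aemeasurable
  have hmf : Measurable fun z => F *ᵥ z := (by fun_prop : Continuous fun z => F *ᵥ z).measurable
  have hmg : Measurable fun z => G *ᵥ z := (by fun_prop : Continuous fun z => G *ᵥ z).measurable
  refine hasLaw_normalLaw_of_integral_exp (h1.add h2)
    ((hmf.comp_aemeasurable hme).add (hmg.comp_aemeasurable hmv)) fun a => ?_
  have i1 := integral_exp_of_hasLaw hS he (Fᵀ *ᵥ a)
  have i2 := integral_exp_of_hasLaw hR hv (Gᵀ *ᵥ a)
  have hind : IndepFun (fun ω => Complex.exp (((Fᵀ *ᵥ a) ⬝ᵥ e ω : ℝ) * Complex.I))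
      (fun ω => Complex.exp (((Gᵀ *ᵥ a) ⬝ᵥ v ω : ℝ) * Complex.I)) μ :=
    hev.comp (φ := fun z => Complex.exp (((Fᵀ *ᵥ a) ⬝ᵥ z : ℝ) * Complex.I))
      (ψ := fun z => Complex.exp (((Gᵀ *ᵥ a) ⬝ᵥ z : ℝ) * Complex.I)) (by fun_prop) (by fun_prop)
  have hp := hind.integral_fun_mul_eq_mul_integral
    (Measurable.comp_aemeasurable (g := fun z => Complex.exp (((Fᵀ *ᵥ a) ⬝ᵥ z : ℝ) * Complex.I))
      (by fun_prop) hme).aestronglyMeasurable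
    (Measurable.comp_aemeasurable (g := fun z => Complex.exp (((Gᵀ *ᵥ a) ⬝ᵥ z : ℝ) * Complex.I))
      (by fun_prop) hmv).aestronglyMeasurable
  rw [i1, i2, ← Complex.exp_add] at hp
  convert hp using 1
  · congr with ω
    rw [← Complex.exp_add]
    congr 1
    rw [dotProduct_add, Matrix.dotProduct_mulVec, Matrix.dotProduct_mulVec, ← mulVec_transpose,
      ← mulVec_transpose]
    push_cast
    ring
  · congr 1
    have q1 : a ⬝ᵥ (F * S * Fᵀ) *ᵥ a = (Fᵀ *ᵥ a) ⬝ᵥ S *ᵥ (Fᵀ *ᵥ a) := by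
      rw [← mulVec_mulVec, ← mulVec_mulVec, Matrix.dotProduct_mulVec, ← mulVec_transpose]
    have q2 : a ⬝ᵥ (G * R * Gᵀ) *ᵥ a = (Gᵀ *ᵥ a) ⬝ᵥ R *ᵥ (Gᵀ *ᵥ a) := by
      rw [← mulVec_mulVec, ← mulVec_mulVec, Matrix.dotProduct_mulVec, ← mulVec_transpose]
    rw [add_mulVec, dotProduct_add, q1, q2]
    push_cast
    ring

end Gaussian

/-! ### The innovations of the steady-state Kalman filter -/

namespace Model

variable {n D : ℕ} (M : Model n D) {Ω : Type*} [MeasurableSpace Ω] {μ : Measure Ω}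

/-- The gain equation K Γ = A Ψ Cᵀ, transposed with Γ and Ψ symmetric. -/
lemma K_transpose : M.Γ * M.Kᵀ = M.C * M.Ψ * M.Aᵀ := by
  have hΓ : M.Γᵀ = M.Γ := by
    have := M.posDef_Γ.isHermitian.eq
    rwa [conjTranspose_eq_transpose_of_trivial] at this
  have hΨ : M.Ψᵀ = M.Ψ := by simpa using M.posSemidef_Ψ.isHermitian.eq
  have hK : M.K = M.A * M.Ψ * M.Cᵀ * M.Γ⁻¹ := rfl
  have hdet : IsUnit M.Γ.det := M.posDef_Γ.det_pos.ne'.isUnit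
  rw [hK, transpose_mul, transpose_nonsing_inv, hΓ, mul_nonsing_inv_cancel_left _ _ hdet]
  simp [transpose_mul, hΨ, Matrix.mul_assoc]

/-- The innovation and the next prediction error are uncorrelated. -/
lemma cross_cov_eq_zero : M.C * M.Ψ * (M.A - M.K * M.C)ᵀ - M.R * M.Kᵀ = 0 := by
  have h := M.K_transpose
  have hΓ : M.Γ = M.C * M.Ψ * M.Cᵀ + M.R := rfl
  rw [hΓ, Matrix.add_mul] at h
  rw [transpose_sub, transpose_mul, Matrix.mul_sub, ← h, ← Matrix.mul_assoc]
  abel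

/-- Whitening: Γ is the covariance of the innovation, so this is the covariance of the normalized
error. -/
lemma sqrt_Γ_inv_mul_mul : (CFC.sqrt M.Γ)⁻¹ * M.Γ * ((CFC.sqrt M.Γ)⁻¹)ᵀ = 1 := by
  have hdet : IsUnit M.Γ.det := M.posDef_Γ.det_pos.ne'.isUnit
  have hs : CFC.sqrt M.Γ * CFC.sqrt M.Γ = M.Γ :=
    CFC.sqrt_mul_sqrt_self _ M.posDef_Γ.posSemidef.nonneg
  have ht : (CFC.sqrt M.Γ)ᵀ = CFC.sqrt M.Γ := by
    simpa [IsSelfAdjoint, star_eq_conjTranspose] using (CFC.sqrt_nonneg M.Γ).isSelfAdjoint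
  have hu : IsUnit (CFC.sqrt M.Γ).det := by
    rw [← hs, det_mul] at hdet
    exact isUnit_of_mul_isUnit_left hdet
  rw [transpose_nonsing_inv, ht]
  nth_rw 2 [← hs]
  rw [← Matrix.mul_assoc, nonsing_inv_mul _ hu, Matrix.one_mul, mul_nonsing_inv _ hu]

variable {M} in
-- The pair is a linear image of the Gaussian vector (e, w, v), so vanishing covariances suffice.
-- The mixed covariances of e, w, v are zero, and what remains is C Ψ (A - K C)ᵀ - R Kᵀ, which is
-- zero by `cross_cov_eq_zero`.
lemma indepFun_innovation [IsProbabilityMeasure μ] {e w : Ω → Fin n → ℝ} {v : Ω → Fin D → ℝ}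
    (he : HasLaw e (normalLaw 0 M.Ψ) μ) (hw : HasLaw w (normalLaw 0 M.Q) μ)
    (hv : HasLaw v (normalLaw 0 M.R) μ) (hewv : IndepFun e (fun ω => (w ω, v ω)) μ)
    (hwv : IndepFun w v μ) :
    IndepFun (fun ω => M.C *ᵥ e ω + v ω)
      (fun ω => (M.A - M.K * M.C) *ᵥ e ω + w ω - M.K *ᵥ v ω) μ := by
  have gw := hw.hasGaussianLaw
  have gv := hv.hasGaussianLaw
  have ge := he.hasGaussianLaw
  have g : HasGaussianLaw (fun ω => (e ω, (w ω, v ω))) μ :=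
    hewv.hasGaussianLaw ge (hwv.hasGaussianLaw gw gv)
  set F := M.A - M.K * M.C with hF
  have hew : IndepFun e w μ := hewv.comp measurable_id measurable_fst
  have hev : IndepFun e v μ := hewv.comp measurable_id measurable_snd
  let L : ((Fin n → ℝ) × (Fin n → ℝ) × (Fin D → ℝ)) →L[ℝ] (Fin D → ℝ) × (Fin n → ℝ) :=
    LinearMap.toContinuousLinearMap
      { toFun := fun p => (M.C *ᵥ p.1 + p.2.2, F *ᵥ p.1 + p.2.1 - M.K *ᵥ p.2.2)
        map_add' := fun p q => by
          ext i
          · simp [mulVec_add]; ring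
          · simp [mulVec_add]; ring
        map_smul' := fun c p => by
          ext i
          · simp [mulVec_smul]
          · simp [mulVec_smul]; ring }
  have gL := g.map_fun L
  refine HasGaussianLaw.indepFun_of_covariance_eval
    (X := fun i ω => (M.C *ᵥ e ω + v ω) i) (Y := fun j ω => (F *ᵥ e ω + w ω - M.K *ᵥ v ω) j) gL ?_
  intro i j
  have me (a : Fin n → ℝ) : MemLp (fun ω => a ⬝ᵥ e ω) 2 μ :=
    memLp_finsetSum _ fun k _ => (ge.eval k).memLp_two.const_mul (a k)
  have mw (a : Fin n → ℝ) : MemLp (fun ω => a ⬝ᵥ w ω) 2 μ :=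
    memLp_finsetSum _ fun k _ => (gw.eval k).memLp_two.const_mul (a k)
  have mv (a : Fin D → ℝ) : MemLp (fun ω => a ⬝ᵥ v ω) 2 μ :=
    memLp_finsetSum _ fun k _ => (gv.eval k).memLp_two.const_mul (a k)
  have e1 : (fun ω => (M.C *ᵥ e ω + v ω) i)
      = (fun ω => M.C i ⬝ᵥ e ω) + fun ω => Pi.single i 1 ⬝ᵥ v ω := by
    ext ω; simp [mulVec]
  have e2 : (fun ω => (F *ᵥ e ω + w ω - M.K *ᵥ v ω) j)
      = (fun ω => F j ⬝ᵥ e ω) + (fun ω => Pi.single j 1 ⬝ᵥ w ω) - fun ω => M.K j ⬝ᵥ v ω := by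
    ext ω; simp [mulVec]
  rw [e1, e2, covariance_add_left (me _) (mv _) (((me _).add (mw _)).sub (mv _)),
    covariance_sub_right (me _) ((me _).add (mw _)) (mv _),
    covariance_sub_right (mv _) ((me _).add (mw _)) (mv _),
    covariance_add_right (me _) (me _) (mw _), covariance_add_right (mv _) (me _) (mw _),
    covariance_dotProduct_of_hasLaw M.posSemidef_Ψ he,
    covariance_dotProduct_of_hasLaw M.posSemidef_R hv]
  have c1 (a b) : cov[fun ω => a ⬝ᵥ e ω, fun ω => b ⬝ᵥ w ω; μ] = 0 :=
    (hew.comp (φ := fun z => a ⬝ᵥ z) (ψ := fun z => b ⬝ᵥ z) (by fun_prop)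
      (by fun_prop)).covariance_eq_zero (me _) (mw _)
  have c2 (a b) : cov[fun ω => a ⬝ᵥ e ω, fun ω => b ⬝ᵥ v ω; μ] = 0 :=
    (hev.comp (φ := fun z => a ⬝ᵥ z) (ψ := fun z => b ⬝ᵥ z) (by fun_prop)
      (by fun_prop)).covariance_eq_zero (me _) (mv _)
  have c3 (a b) : cov[fun ω => a ⬝ᵥ v ω, fun ω => b ⬝ᵥ e ω; μ] = 0 := by
    rw [covariance_comm, c2]
  have c4 (a b) : cov[fun ω => a ⬝ᵥ v ω, fun ω => b ⬝ᵥ w ω; μ] = 0 :=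
    (hwv.symm.comp (φ := fun z => a ⬝ᵥ z) (ψ := fun z => b ⬝ᵥ z) (by fun_prop)
      (by fun_prop)).covariance_eq_zero (mv _) (mw _)
  rw [c1, c2, c3, c4]
  have hz := congrFun (congrFun M.cross_cov_eq_zero i) j
  have z1 : (M.C * M.Ψ * (M.A - M.K * M.C)ᵀ) i j = M.C i ⬝ᵥ M.Ψ *ᵥ F j := by
    rw [Matrix.mul_assoc, mul_apply_eq_vecMul, vecMul, ← hF]
    rfl
  have z2 : (M.R * M.Kᵀ) i j = Pi.single i 1 ⬝ᵥ M.R *ᵥ M.K j := by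
    simp only [single_one_dotProduct]
    rfl
  rw [Matrix.sub_apply, z1, z2] at hz
  rw [Matrix.zero_apply] at hz
  linarith

variable {M} in
lemma hasLaw_normalized [IsProbabilityMeasure μ] {e : Ω → Fin n → ℝ} {v : Ω → Fin D → ℝ}
    (he : HasLaw e (normalLaw 0 M.Ψ) μ) (hv : HasLaw v (normalLaw 0 M.R) μ)
    (hev : IndepFun e v μ) :
    HasLaw (fun ω => (CFC.sqrt M.Γ)⁻¹ *ᵥ (M.C *ᵥ e ω + v ω)) (normalLaw 0 1) μ := by
  have h := hasLaw_add_of_indepFun M.posSemidef_Ψ M.posSemidef_R he hv hev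
    ((CFC.sqrt M.Γ)⁻¹ * M.C) (CFC.sqrt M.Γ)⁻¹
  convert h using 1
  · ext1 ω
    rw [mulVec_add, mulVec_mulVec]
  · rw [← M.sqrt_Γ_inv_mul_mul, show M.Γ = M.C * M.Ψ * M.Cᵀ + M.R from rfl, Matrix.mul_add,
      Matrix.add_mul, transpose_mul]
    simp only [Matrix.mul_assoc]

end Model

namespace Model

variable {n D : ℕ} {M : Model n D} {Ω : Type*} [MeasurableSpace Ω] {μ : Measure Ω}
  {x w : ℤ → Ω → Fin n → ℝ} {v y : ℤ → Ω → Fin D → ℝ} {xhat : ℤ → Ω → Fin n → ℝ}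

namespace IsSteadyState

lemma measurable_normError :
    Measurable fun p : (Fin D → ℝ) × (Fin n → ℝ) => M.normError p.1 p.2 := by
  unfold normError
  exact (by fun_prop : Continuous fun p : (Fin D → ℝ) × (Fin n → ℝ) =>
    (CFC.sqrt M.Γ)⁻¹ *ᵥ (p.1 - M.C *ᵥ p.2)).measurable

lemma normError_eq (h : M.IsSteadyState μ x w v y xhat) (t : ℤ) :
    (fun ω => M.normError (y t ω) (xhat t ω)) =ᵐ[μ]
    fun ω => (CFC.sqrt M.Γ)⁻¹ *ᵥ (M.C *ᵥ (x t ω - xhat t ω) + v t ω) := by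
  filter_upwards [h.output t] with ω hω
  rw [normError, hω, mulVec_sub M.C, add_sub_right_comm]

/-- State and filter share the dynamics A, and the measurement enters the filter only through C (x -
x̂) + v, so the recursion closes on the difference. -/
lemma error_succ (h : M.IsSteadyState μ x w v y xhat) (t : ℤ) :
    (fun ω => x (t + 1) ω - xhat (t + 1) ω) =ᵐ[μ]
    fun ω => (M.A - M.K * M.C) *ᵥ (x t ω - xhat t ω) + w t ω - M.K *ᵥ v t ω := by
  filter_upwards [h.state t, h.output t, h.isFilter t] with ω h1 h2 h3
  rw [h1, h3, h2, sub_mulVec, mulVec_sub, mulVec_sub, mulVec_sub, mulVec_add, ← mulVec_mulVec,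
    ← mulVec_mulVec]
  abel

lemma indepFun_error_noise (h : M.IsSteadyState μ x w v y xhat) (t : ℤ) :
    IndepFun (fun ω => x t ω - xhat t ω) (fun ω => (w t ω, v t ω)) μ :=
  (h.indep_future t).comp (φ := fun p : (Fin n → ℝ) × (Fin n → ℝ) => p.1 - p.2)
    (ψ := fun f : {s : ℤ // t ≤ s} → (Fin n → ℝ) × (Fin D → ℝ) => f ⟨t, le_rfl⟩)
    (by fun_prop) (measurable_pi_apply _)

variable [IsProbabilityMeasure μ]

lemma hasLaw_normError (h : M.IsSteadyState μ x w v y xhat) (t : ℤ) :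
    HasLaw (fun ω => M.normError (y t ω) (xhat t ω)) (normalLaw 0 1) μ :=
  (hasLaw_normalized (h.law_error t) (h.law_v t)
    ((h.indepFun_error_noise t).comp measurable_id measurable_snd)).congr (h.normError_eq t)

/-- The normalized prediction errors at the times `t, …, t + k - 1`, together with the state
prediction error at time `t + k`, are independent of the noises from time `t + k` on. -/
lemma indepFun_past_future (h : M.IsSteadyState μ x w v y xhat) (t : ℤ) (k : ℕ) :
    IndepFun (fun ω => ((fun i : Fin k => M.normError (y (t + (i : ℕ)) ω) (xhat (t + (i : ℕ)) ω)),
        x (t + k) ω - xhat (t + k) ω))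
      (fun ω (s : {s : ℤ // t + k ≤ s}) => (w s ω, v s ω)) μ := by
  induction k with
  | zero =>
    have := (h.indep_future (t + (0 : ℕ))).comp (φ := fun p => ((fun i : Fin 0 => (0 : Fin D → ℝ)),
      p.1 - p.2)) (ψ := id) (by fun_prop) measurable_id
    rw [Function.id_comp] at this
    convert this using 1
    ext1 ω
    simp only [Function.comp]
    congr 1
    exact Subsingleton.elim _ _
  | succ k ih =>
    set s₀ : ℤ := t + k with hs₀
    have hs₁ : t + ((k + 1 : ℕ) : ℤ) = s₀ + 1 := by push_cast; ring
    have hmN (s : ℤ) : AEMeasurable (fun ω => (w s ω, v s ω)) μ :=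
      (h.law_w s).aemeasurable.prodMk (h.law_v s).aemeasurable
    have hmE (s : ℤ) : AEMeasurable (fun ω => M.normError (y s ω) (xhat s ω)) μ :=
      (h.hasLaw_normError s).aemeasurable
    have hmX (s : ℤ) := (h.law_error s).aemeasurable
    have hmU : AEMeasurable (fun ω => ((fun i : Fin k =>
        M.normError (y (t + (i : ℕ)) ω) (xhat (t + (i : ℕ)) ω)), x s₀ ω - xhat s₀ ω)) μ :=
      (aemeasurable_pi_lambda _ fun i => hmE _).prodMk (hmX _)
    have hN : IndepFun (fun ω => (w s₀ ω, v s₀ ω))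
        (fun ω (s : {s : ℤ // s₀ + 1 ≤ s}) => (w s ω, v s ω)) μ := by
      have := indepFun_of_disjoint h.indep_noise hmN
        (S := {s₀}) (T := {s | s₀ + 1 ≤ s}) (by simp)
      exact this.comp 
        (φ := fun f : ({s₀} : Set ℤ) → (Fin n → ℝ) × (Fin D → ℝ) => f ⟨s₀, rfl⟩) (ψ := id)
        (measurable_pi_apply _) measurable_id
    have hU : IndepFun (fun ω => ((fun i : Fin k =>
        M.normError (y (t + (i : ℕ)) ω) (xhat (t + (i : ℕ)) ω)), x s₀ ω - xhat s₀ ω))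
        (fun ω => ((w s₀ ω, v s₀ ω),
          fun s : {s : ℤ // s₀ + 1 ≤ s} => (w s ω, v s ω))) μ :=
      ih.comp (φ := id) (ψ := fun f : {s : ℤ // s₀ ≤ s} → (Fin n → ℝ) × (Fin D → ℝ) =>
        (f ⟨s₀, le_rfl⟩,
          fun s : {s : ℤ // s₀ + 1 ≤ s} => f ⟨s, (by omega : s₀ ≤ s₀ + 1).trans s.2⟩))
        measurable_id ((measurable_pi_apply _).prodMk
          (measurable_pi_lambda _ fun s => measurable_pi_apply _))
    have key := indepFun_prodMk_left_of_right hmU (hmN s₀)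
      (aemeasurable_pi_lambda _ fun s => hmN _) hU hN
    rw [hs₁]
    -- One time step: the appended innovation and the next state error are functions of the current
    -- state error and the current noise only.
    have hφ : Measurable fun p : ((Fin k → Fin D → ℝ) × (Fin n → ℝ)) × (Fin n → ℝ) × (Fin D → ℝ) =>
        ((fun i : Fin (k + 1) => if hi : (i : ℕ) < k then p.1.1 ⟨i, hi⟩ else
          (CFC.sqrt M.Γ)⁻¹ *ᵥ (M.C *ᵥ p.1.2 + p.2.2)),
          (M.A - M.K * M.C) *ᵥ p.1.2 + p.2.1 - M.K *ᵥ p.2.2) := by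
      refine Continuous.measurable ?_
      refine .prodMk (continuous_pi fun i => ?_) (by fun_prop)
      split_ifs <;> fun_prop
    refine (key.comp hφ measurable_id).congr ?_ (ae_eq_refl _)
    filter_upwards [h.normError_eq s₀, h.error_succ s₀] with ω h1 h2
    simp only [Function.comp]
    refine Prod.ext ?_ h2.symm
    ext1 i
    by_cases hi : (i : ℕ) < k
    · simp [hi]
    · have hik : (i : ℕ) = k := by omega
      simp only [hik, ← hs₀, lt_irrefl, dite_false]
      exact h1.symm

/-- The first independence carries the induction. If the past is independent of the current state
error, then it is independent of that error together with the current noise, hence of the current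
innovation and the next state error jointly. Since these two are independent of each other, the
current innovation can be moved to the past. -/
lemma indepFun_past_error (h : M.IsSteadyState μ x w v y xhat) (t : ℤ) (k : ℕ) :
    IndepFun (fun ω (i : Fin k) => M.normError (y (t + (i : ℕ)) ω) (xhat (t + (i : ℕ)) ω))
        (fun ω => x (t + k) ω - xhat (t + k) ω) μ ∧
      IndepFun (fun ω (i : Fin k) => M.normError (y (t + (i : ℕ)) ω) (xhat (t + (i : ℕ)) ω))
        (fun ω => M.normError (y (t + k) ω) (xhat (t + k) ω)) μ := by
  have hmE (s : ℤ) : AEMeasurable (fun ω => M.normError (y s ω) (xhat s ω)) μ :=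
    (h.hasLaw_normError s).aemeasurable
  have hmX (s : ℤ) := (h.law_error s).aemeasurable
  have hmN (s : ℤ) : AEMeasurable (fun ω => (w s ω, v s ω)) μ :=
    (h.law_w s).aemeasurable.prodMk (h.law_v s).aemeasurable
  have step (k : ℕ) (ih : IndepFun
      (fun ω (i : Fin k) => M.normError (y (t + (i : ℕ)) ω) (xhat (t + (i : ℕ)) ω))
      (fun ω => x (t + k) ω - xhat (t + k) ω) μ) :
      IndepFun (fun ω (i : Fin k) => M.normError (y (t + (i : ℕ)) ω) (xhat (t + (i : ℕ)) ω))
        (fun ω => (M.normError (y (t + k) ω) (xhat (t + k) ω),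
          x (t + k + 1) ω - xhat (t + k + 1) ω)) μ := by
    have he : Measurable fun f : {s : ℤ // t + k ≤ s} → (Fin n → ℝ) × (Fin D → ℝ) =>
      f ⟨t + k, le_rfl⟩ := measurable_pi_apply _
    have h1 := (h.indepFun_past_future t k).comp measurable_id he
    have h2 := indepFun_prodMk_right_of_left (aemeasurable_pi_lambda _ fun i => hmE _)
      (hmX (t + k)) (hmN (t + k)) h1 ih
    have hψ : Measurable fun p : (Fin n → ℝ) × (Fin n → ℝ) × (Fin D → ℝ) =>
        ((CFC.sqrt M.Γ)⁻¹ *ᵥ (M.C *ᵥ p.1 + p.2.2),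
          (M.A - M.K * M.C) *ᵥ p.1 + p.2.1 - M.K *ᵥ p.2.2) :=
      Continuous.measurable (by fun_prop)
    refine (h2.comp measurable_id hψ).congr (ae_eq_refl _) ?_
    filter_upwards [h.normError_eq (t + k), h.error_succ (t + k)] with ω h1 h2
    exact Prod.ext h1.symm h2.symm
  have main : IndepFun
      (fun ω (i : Fin k) => M.normError (y (t + (i : ℕ)) ω) (xhat (t + (i : ℕ)) ω))
      (fun ω => x (t + k) ω - xhat (t + k) ω) μ := by
    induction k with
    | zero =>
      exact indepFun_fin_zero _ _
    | succ k ih =>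
      have hs : t + ((k + 1 : ℕ) : ℤ) = t + k + 1 := by push_cast; ring
      -- This is where the choice of the Kalman gain enters.
      have hcur : IndepFun (fun ω => M.normError (y (t + k) ω) (xhat (t + k) ω))
          (fun ω => x (t + k + 1) ω - xhat (t + k + 1) ω) μ := by
        have h3 := (indepFun_innovation (h.law_error (t + k)) (h.law_w _) (h.law_v _)
          (h.indepFun_error_noise (t + k)) (h.indep_wv _)).comp
          (φ := fun z => (CFC.sqrt M.Γ)⁻¹ *ᵥ z) (ψ := id)
          (Continuous.measurable (by fun_prop)) measurable_id
        exact h3.congr (h.normError_eq _).symm (h.error_succ _).symm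
      have h4 := indepFun_prodMk_left_of_right (aemeasurable_pi_lambda _ fun i => hmE _)
        (hmE (t + k)) (hmX (t + k + 1)) (step k ih) hcur
      rw [hs]
      have hφ : Measurable fun p : (Fin k → Fin D → ℝ) × (Fin D → ℝ) =>
          (fun i : Fin (k + 1) => if hi : (i : ℕ) < k then p.1 ⟨i, hi⟩ else p.2) := by
        refine measurable_pi_lambda _ fun i => ?_
        split_ifs <;> fun_prop
      have h5 := h4.comp hφ measurable_id
      rw [Function.id_comp] at h5
      convert h5 using 1
      ext ω i
      by_cases hi : (i : ℕ) < k
      · simp [hi]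
      · have hik : (i : ℕ) = k := by omega
        simp [hik]
  exact ⟨main, (step k main).comp measurable_id measurable_fst⟩

/-- The normalized prediction errors of the steady-state Kalman filter are independent standard
normal vectors. -/
theorem map_errorPath (h : M.IsSteadyState μ x w v y xhat) :
    μ.map (M.errorPath y xhat) = Measure.infinitePi fun _ : ℤ => normalLaw 0 1 := by
  have hi : iIndepFun (fun t ω => M.normError (y t ω) (xhat t ω)) μ :=
    iIndepFun_int fun t => iIndepFun_of_indepFun_past fun k => (h.indepFun_past_error t k).2
  have := hi.map_fun_eq_infinitePi_map₀' fun t => (h.hasLaw_normError t).aemeasurable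
  simp only [fun t => (h.hasLaw_normError t).map_eq] at this
  exact this

end IsSteadyState
end Model

/-! ### Central limit theorem for bounded stationary `m`-dependent sequences -/

section MDependent

variable {Ω : Type*} [MeasurableSpace Ω] {μ : Measure Ω}

/-- A centered bounded stationary sequence such that the variables up to time `a - 1` are
independent of those from time `a + L` on. -/
structure IsMDependent (μ : Measure Ω) (Y : ℕ → Ω → ℝ) (B : ℝ) (L : ℕ) : Prop where
  measurable : ∀ s, Measurable (Y s)
  abs_le : ∀ s ω, |Y s ω| ≤ B
  integral_eq_zero : ∀ s, ∫ ω, Y s ω ∂μ = 0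
  stationary : ∀ k, IdentDistrib (fun ω s => Y (k + s) ω) (fun ω s => Y s ω) μ μ
  indep : ∀ a, IndepFun (fun ω (s : Fin a) => Y s ω) (fun ω (s : ℕ) => Y (a + L + s) ω) μ

/-- The autocovariance of a centered sequence at lag `d`. -/
noncomputable def autocov (μ : Measure Ω) (Y : ℕ → Ω → ℝ) (d : ℕ) : ℝ := ∫ ω, Y d ω * Y 0 ω ∂μ

/-- The long-run variance of a centered sequence whose autocovariance vanishes beyond lag `L`. -/
noncomputable def longRunVar (μ : Measure Ω) (Y : ℕ → Ω → ℝ) (L : ℕ) : ℝ :=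
  autocov μ Y 0 + 2 * ∑ d ∈ Finset.range L, autocov μ Y (d + 1)

lemma norm_exp_sub_exp_le (a b : ℝ) :
    ‖Complex.exp ((a : ℂ) * Complex.I) - Complex.exp ((b : ℂ) * Complex.I)‖ ≤ |a - b| := by
  have e : Complex.exp ((a : ℂ) * Complex.I) - Complex.exp ((b : ℂ) * Complex.I)
      = Complex.exp ((b : ℂ) * Complex.I) * (Complex.exp (Complex.I * ((a - b : ℝ) : ℂ)) - 1) := by
    rw [mul_sub, ← Complex.exp_add, mul_one]
    congr 2
    push_cast
    ring
  rw [e, norm_mul, Complex.norm_exp_ofReal_mul_I, one_mul]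
  exact Real.norm_exp_I_mul_ofReal_sub_one_le

lemma integral_abs_le_sqrt [IsProbabilityMeasure μ] {W : Ω → ℝ} (hW : MemLp W 2 μ) :
    ∫ ω, |W ω| ∂μ ≤ √(∫ ω, W ω ^ 2 ∂μ) := by
  have h := variance_nonneg |W| μ
  rw [variance_eq_sub hW.abs] at h
  simp only [Pi.pow_apply, Pi.abs_apply, sq_abs] at h
  exact Real.le_sqrt_of_sq_le (by linarith)

lemma integrable_exp_mul_I [IsFiniteMeasure μ] {X : Ω → ℝ} (hX : Measurable X) :
    Integrable (fun ω => Complex.exp ((X ω : ℂ) * Complex.I)) μ :=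
  Integrable.of_bound (by fun_prop) 1 (ae_of_all _ fun ω => by
    rw [Complex.norm_exp_ofReal_mul_I])

/-- The map t ↦ exp(it) is 1-Lipschitz, so discarding a term costs at most its L¹ norm. This form
serves for the bounded remainder; the L² form below serves for block sums, whose second moments are
known. -/
lemma norm_integral_exp_sub_le_integral [IsProbabilityMeasure μ] {X Z : Ω → ℝ} (hX : Measurable X)
    (hZ : Measurable Z) (hXZ : Integrable (fun ω => X ω - Z ω) μ) :
    ‖∫ ω, Complex.exp ((X ω : ℂ) * Complex.I) ∂μ - ∫ ω, Complex.exp ((Z ω : ℂ) * Complex.I) ∂μ‖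
      ≤ ∫ ω, |X ω - Z ω| ∂μ := by
  rw [← integral_sub (integrable_exp_mul_I hX) (integrable_exp_mul_I hZ)]
  exact norm_integral_le_of_norm_le hXZ.abs (ae_of_all _ fun ω => norm_exp_sub_exp_le _ _)

lemma norm_integral_exp_sub_le_sqrt [IsProbabilityMeasure μ] {X Z : Ω → ℝ} (hX : Measurable X)
    (hZ : Measurable Z) (hXZ : MemLp (fun ω => X ω - Z ω) 2 μ) :
    ‖∫ ω, Complex.exp ((X ω : ℂ) * Complex.I) ∂μ - ∫ ω, Complex.exp ((Z ω : ℂ) * Complex.I) ∂μ‖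
      ≤ √(∫ ω, (X ω - Z ω) ^ 2 ∂μ) :=
  (norm_integral_exp_sub_le_integral hX hZ (hXZ.integrable (by simp))).trans
    (integral_abs_le_sqrt hXZ)

/-- The sum of the variables in the `j`-th block, which starts at time `j * K + o` and has
length `l`. -/
def blockSum (Y : ℕ → Ω → ℝ) (K o l j : ℕ) (ω : Ω) : ℝ :=
  ∑ i ∈ Finset.range l, Y (j * K + o + i) ω

lemma sum_range_mul_add (f : ℕ → ℝ) (K N : ℕ) :
    ∑ s ∈ Finset.range (N * K), f s
      = ∑ j ∈ Finset.range N, ∑ i ∈ Finset.range K, f (j * K + i) := by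
  induction N with
  | zero => simp
  | succ N ih => rw [Nat.succ_mul, Finset.sum_range_add, ih, Finset.sum_range_succ]

/-- Bernstein's decomposition: big blocks of length k, small blocks of length L filling the gaps,
and an incomplete last period. -/
lemma sum_range_eq_blockSum {Ω : Type*} (Y : ℕ → Ω → ℝ) (k L T : ℕ) (ω : Ω) :
    ∑ s ∈ Finset.range T, Y s ω
      = ∑ j ∈ Finset.range (T / (k + L)), blockSum Y (k + L) 0 k j ω
        + ∑ j ∈ Finset.range (T / (k + L)), blockSum Y (k + L) k L j ω
        + ∑ i ∈ Finset.range (T % (k + L)), Y (T / (k + L) * (k + L) + i) ω := by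
  conv_lhs => rw [← Nat.div_add_mod' T (k + L)]
  rw [Finset.sum_range_add, sum_range_mul_add, ← Finset.sum_add_distrib]
  congr 1
  refine Finset.sum_congr rfl fun j _ => ?_
  rw [Finset.sum_range_add]
  simp only [blockSum, add_zero, add_assoc]

namespace IsMDependent

variable {Y : ℕ → Ω → ℝ} {B : ℝ} {L : ℕ}

lemma memLp [IsProbabilityMeasure μ] (h : IsMDependent μ Y B L) (s : ℕ) (p : ℝ≥0∞) :
    MemLp (Y s) p μ :=
  MemLp.of_bound (h.measurable s).aestronglyMeasurable B (ae_of_all _ (h.abs_le s))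

lemma measurable_blockSum (h : IsMDependent μ Y B L) (K o l j : ℕ) :
    Measurable (blockSum Y K o l j) :=
  Finset.measurable_fun_sum _ fun _ _ => h.measurable _

lemma memLp_blockSum [IsProbabilityMeasure μ] (h : IsMDependent μ Y B L) (K o l j : ℕ) :
    MemLp (blockSum Y K o l j) 2 μ :=
  memLp_finsetSum _ fun _ _ => h.memLp _ _

lemma identDistrib_blockSum (h : IsMDependent μ Y B L) (K o l j : ℕ) :
    IdentDistrib (blockSum Y K o l j) (fun ω => ∑ i ∈ Finset.range l, Y i ω) μ μ :=
  (h.stationary (j * K + o)).comp (u := fun f : ℕ → ℝ => ∑ i ∈ Finset.range l, f i) (by fun_prop)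

lemma integral_sum_eq_zero [IsProbabilityMeasure μ] (h : IsMDependent μ Y B L) (l : ℕ) :
    ∫ ω, ∑ i ∈ Finset.range l, Y i ω ∂μ = 0 := by
  rw [integral_finsetSum _ fun i _ => (h.memLp i 1).integrable le_rfl]
  exact Finset.sum_eq_zero fun i _ => h.integral_eq_zero i

/-- A block of length l in a period K ≥ l + L leaves a gap of at least L before the next block, so
each block is independent of all earlier ones. -/
lemma iIndepFun_blockSum [IsProbabilityMeasure μ] (h : IsMDependent μ Y B L) {K l : ℕ} (o : ℕ)
    (hl : l + L ≤ K) : iIndepFun (blockSum Y K o l) μ := by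
  refine iIndepFun_of_indepFun_past fun j => ?_
  obtain _ | j := j
  · exact indepFun_fin_zero _ _
  have hK : (j + 1) * K = j * K + K := by ring
  have ha : (j + 1) * K + o - L + L = (j + 1) * K + o := by omega
  -- The time `(j + 1) * K + o - L` lies at or beyond the end of block j, so the default 0 below is
  -- never used; the subtraction is not truncated, since L ≤ K.
  have key := (h.indep ((j + 1) * K + o - L)).comp
    (φ := fun f (r : Fin (j + 1)) => ∑ i ∈ Finset.range l,
      if hi : r * K + o + i < (j + 1) * K + o - L then f ⟨r * K + o + i, hi⟩ else 0)
    (ψ := fun f => ∑ i ∈ Finset.range l, f i)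
    (measurable_pi_lambda _ fun r => Finset.measurable_fun_sum _ fun i _ => by
      split_ifs
      · exact measurable_pi_apply _
      · exact measurable_const) (by fun_prop)
  convert key using 1
  · ext ω r
    refine Finset.sum_congr rfl fun i hi => ?_
    have hi := Finset.mem_range.1 hi
    have hr : (r : ℕ) * K ≤ j * K := Nat.mul_le_mul_right _ (by omega)
    rw [dif_pos (by omega)]
  · ext ω
    simp only [blockSum, Function.comp, ha]

lemma integral_sq_sum_blockSum [IsProbabilityMeasure μ] (h : IsMDependent μ Y B L) {K l : ℕ} (o : ℕ)
    (hl : l + L ≤ K) (N : ℕ) :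
    ∫ ω, (∑ j ∈ Finset.range N, blockSum Y K o l j ω) ^ 2 ∂μ
      = N * ∫ ω, (∑ i ∈ Finset.range l, Y i ω) ^ 2 ∂μ := by
  have hi := h.iIndepFun_blockSum o hl
  have hz (j : ℕ) : ∫ ω, blockSum Y K o l j ω ∂μ = 0 :=
    (h.identDistrib_blockSum K o l j).integral_eq.trans (h.integral_sum_eq_zero l)
  have hv := IndepFun.variance_sum (s := Finset.range N) (X := blockSum Y K o l)
    (fun j _ => h.memLp_blockSum K o l j) (fun i _ j _ hij => hi.indepFun hij)
  rw [variance_of_integral_eq_zero] at hv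
  · simp only [Finset.sum_apply] at hv
    rw [hv, Finset.sum_congr rfl fun j _ => (h.identDistrib_blockSum K o l j).variance_eq,
      variance_of_integral_eq_zero _ (h.integral_sum_eq_zero l)]
    · simp
    · exact (Finset.measurable_fun_sum _ fun _ _ => h.measurable _).aemeasurable
  · exact (Finset.aemeasurable_sum _ fun j _ => (h.measurable_blockSum K o l j).aemeasurable)
  · simp only [Finset.sum_apply]
    rw [integral_finsetSum _ fun j _ => (h.memLp_blockSum K o l j).integrable (by simp)]
    exact Finset.sum_eq_zero fun j _ => hz j

lemma integral_mul (h : IsMDependent μ Y B L) {i n : ℕ} (hin : i ≤ n) :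
    ∫ ω, Y i ω * Y n ω ∂μ = autocov μ Y (n - i) := by
  have := ((h.stationary i).comp (u := fun f => f 0 * f (n - i)) (by fun_prop)).integral_eq
  simp only [Function.comp, add_zero, Nat.add_sub_cancel' hin] at this
  rw [this, autocov]
  simp only [mul_comm]

lemma autocov_eq_zero [IsProbabilityMeasure μ] (h : IsMDependent μ Y B L) {d : ℕ} (hd : L < d) :
    autocov μ Y d = 0 := by
  have hφ : Measurable fun f : Fin 1 → ℝ => f 0 := measurable_pi_apply 0
  have hψ : Measurable fun f : ℕ → ℝ => f (d - (1 + L)) := measurable_pi_apply _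
  have key := (h.indep 1).comp hφ hψ
  have e : 1 + L + (d - (1 + L)) = d := by omega
  have := key.symm.integral_mul_eq_mul_integral
    (by simpa [Function.comp_def] using (h.measurable _).aestronglyMeasurable)
    (by simpa [Function.comp_def] using (h.measurable _).aestronglyMeasurable)
  simp only [Function.comp_def, e] at this
  rw [autocov]
  refine this.trans ?_
  rw [h.integral_eq_zero, zero_mul]

/-- The new term adds its variance and twice its covariances with the earlier ones. Lags beyond L
contribute nothing, and for n ≥ L all lags 1, …, L occur, so the increment no longer depends on n.
-/
lemma integral_sq_sum_succ [IsProbabilityMeasure μ] (h : IsMDependent μ Y B L) {n : ℕ}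
    (hn : L ≤ n) :
    ∫ ω, (∑ i ∈ Finset.range (n + 1), Y i ω) ^ 2 ∂μ
      = ∫ ω, (∑ i ∈ Finset.range n, Y i ω) ^ 2 ∂μ + longRunVar μ Y L := by
  have hS : MemLp (fun ω => ∑ i ∈ Finset.range n, Y i ω) 2 μ :=
    memLp_finsetSum _ fun i _ => h.memLp i 2
  have e (ω : Ω) : (∑ i ∈ Finset.range (n + 1), Y i ω) ^ 2
      = (∑ i ∈ Finset.range n, Y i ω) ^ 2
        + (2 * ∑ i ∈ Finset.range n, Y i ω * Y n ω + Y n ω * Y n ω) := by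
    rw [Finset.sum_range_succ, ← Finset.sum_mul]
    ring
  have hint (i : ℕ) : Integrable (fun ω => Y i ω * Y n ω) μ :=
    (h.memLp i 2).integrable_mul (h.memLp n 2)
  have hsum : Integrable (fun ω => ∑ i ∈ Finset.range n, Y i ω * Y n ω) μ :=
    integrable_finsetSum _ fun i _ => hint i
  simp only [e]
  have hint2 : Integrable
      (fun ω => 2 * ∑ i ∈ Finset.range n, Y i ω * Y n ω + Y n ω * Y n ω) μ :=
    (hsum.const_mul 2).add (hint n)
  rw [integral_add hS.integrable_sq hint2, integral_add (hsum.const_mul 2) (hint n),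
    integral_const_mul,
    integral_finsetSum _ fun i _ => hint i, h.integral_mul le_rfl, Nat.sub_self, longRunVar,
    add_comm (autocov μ Y 0)]
  congr 3
  rw [Finset.sum_congr rfl fun i hi => h.integral_mul (Finset.mem_range.1 hi).le,
    ← Finset.sum_range_reflect]
  rw [Finset.sum_subset (Finset.range_mono hn) fun d _ hd => h.autocov_eq_zero
    (by rw [Finset.mem_range] at hd; omega)]
  refine Finset.sum_congr rfl fun d hd => ?_
  rw [Finset.mem_range] at hd
  congr 1
  omega

lemma integral_sq_sum_add [IsProbabilityMeasure μ] (h : IsMDependent μ Y B L) (m : ℕ) :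
    ∫ ω, (∑ i ∈ Finset.range (L + m), Y i ω) ^ 2 ∂μ
      = ∫ ω, (∑ i ∈ Finset.range L, Y i ω) ^ 2 ∂μ + m * longRunVar μ Y L := by
  induction m with
  | zero => simp
  | succ m ih =>
    rw [← add_assoc, h.integral_sq_sum_succ (by omega), ih]
    push_cast
    ring

end IsMDependent

end MDependent

namespace IsMDependent

variable {Ω : Type*} [MeasurableSpace Ω] {μ : Measure Ω} [IsProbabilityMeasure μ]
  {Y : ℕ → Ω → ℝ} {B : ℝ} {L : ℕ}

/-- The sum over the big blocks of length `k`, normalized by the number of blocks and by the square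
root of the period `k + L`, is asymptotically normal. -/
lemma tendsto_integral_exp_bigBlocks (h : IsMDependent μ Y B L) (k : ℕ) :
    Tendsto (fun N : ℕ => ∫ ω, Complex.exp (((√((k + L : ℕ) : ℝ))⁻¹ * ((√(N : ℝ))⁻¹ *
        ∑ j ∈ Finset.range N, blockSum Y (k + L) 0 k j ω) : ℝ) * Complex.I) ∂μ) atTop
      (𝓝 (Complex.exp (-(((∫ ω, (∑ i ∈ Finset.range k, Y i ω) ^ 2 ∂μ) / (k + L : ℕ) : ℝ) : ℂ)
        / 2))) := by
  set Z := blockSum Y (k + L) 0 k with hZ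
  have hz : ∫ ω, Z 0 ω ∂μ = 0 :=
    (h.identDistrib_blockSum (k + L) 0 k 0).integral_eq.trans (h.integral_sum_eq_zero k)
  have hvar : Var[Z 0; μ] = ∫ ω, (∑ i ∈ Finset.range k, Y i ω) ^ 2 ∂μ := by
    rw [(h.identDistrib_blockSum (k + L) 0 k 0).variance_eq,
      variance_of_integral_eq_zero _ (h.integral_sum_eq_zero k)]
    exact (Finset.measurable_fun_sum _ fun _ _ => h.measurable _).aemeasurable
  have clt := tendstoInDistribution_inv_sqrt_mul_sum_sub (P := μ) (X := Z)
    (Y := (id : ℝ → ℝ)) (P' := gaussianReal 0 Var[Z 0; μ].toNNReal) HasLaw.id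
    (h.memLp_blockSum _ _ _ _) (h.iIndepFun_blockSum 0 le_rfl)
    (fun i => (h.identDistrib_blockSum _ _ _ i).trans (h.identDistrib_blockSum _ _ _ 0).symm)
  -- Evaluation at 1/√(k + L) accounts for one big block per period of length k + L.
  have key := ProbabilityMeasure.tendsto_iff_tendsto_charFun.1 clt.tendsto
    (√((k + L : ℕ) : ℝ))⁻¹
  simp only [ProbabilityMeasure.coe_mk, Measure.map_id, charFun_gaussianReal, hz, mul_zero,
    sub_zero] at key
  have hmeas (N : ℕ) : Measurable fun ω => (√(N : ℝ))⁻¹ * ∑ j ∈ Finset.range N, Z j ω :=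
    (Finset.measurable_fun_sum _ fun j _ => h.measurable_blockSum _ _ _ j).const_mul _
  convert key using 2 with N
  · rw [charFun_apply_real, integral_map (hmeas N).aemeasurable (by fun_prop)]
    congr with ω
    push_cast
    rfl
  · rw [Real.coe_toNNReal _ (variance_nonneg _ _), hvar]
    have hs : ((√((k + L : ℕ) : ℝ))⁻¹) ^ 2 = ((k + L : ℕ) : ℝ)⁻¹ := by
      rw [inv_pow, Real.sq_sqrt (Nat.cast_nonneg _)]
    rw [← Complex.ofReal_pow, hs]
    congr 1
    push_cast
    ring

/-- The three terms are the costs of dropping the incomplete period (fewer than k + L variables), of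
dropping the small blocks (an L² bound), and of replacing 1/√T by 1/√((k + L) N), where N is the
number of complete periods. -/
lemma norm_integral_exp_sub_bigBlocks_le (h : IsMDependent μ Y B L) {k T : ℕ} (hk : L ≤ k)
    (hk0 : 0 < k) (hT : 0 < T) :
    ‖∫ ω, Complex.exp (((√(T : ℝ))⁻¹ * ∑ s ∈ Finset.range T, Y s ω : ℝ) * Complex.I) ∂μ
      - ∫ ω, Complex.exp (((√((k + L : ℕ) : ℝ))⁻¹ * ((√((T / (k + L) : ℕ) : ℝ))⁻¹ *
        ∑ j ∈ Finset.range (T / (k + L)), blockSum Y (k + L) 0 k j ω) : ℝ) * Complex.I) ∂μ‖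
      ≤ (k + L : ℕ) * |B| * (√(T : ℝ))⁻¹
        + √((∫ ω, (∑ i ∈ Finset.range L, Y i ω) ^ 2 ∂μ) / (k + L : ℕ))
        + |√(((T / (k + L) : ℕ) : ℝ) / T) - (√((k + L : ℕ) : ℝ))⁻¹|
          * √(∫ ω, (∑ i ∈ Finset.range k, Y i ω) ^ 2 ∂μ) := by
  set K := k + L with hK
  set N := T / K with hN
  have hK0 : 0 < (K : ℝ) := by positivity
  have hT0 : 0 < (T : ℝ) := by positivity
  set a := (√(T : ℝ))⁻¹ with ha
  have ha0 : 0 ≤ a := by positivity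
  have hasq : a ^ 2 = (T : ℝ)⁻¹ := by rw [ha, inv_pow, Real.sq_sqrt hT0.le]
  set U : Ω → ℝ := fun ω => ∑ j ∈ Finset.range N, blockSum Y K 0 k j ω with hU
  set V : Ω → ℝ := fun ω => ∑ j ∈ Finset.range N, blockSum Y K k L j ω with hV
  set W : Ω → ℝ := fun ω => ∑ i ∈ Finset.range (T % K), Y (N * K + i) ω with hW
  have mU : Measurable U := Finset.measurable_fun_sum _ fun j _ => h.measurable_blockSum _ _ _ j
  have mV : Measurable V := Finset.measurable_fun_sum _ fun j _ => h.measurable_blockSum _ _ _ j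
  have mW : Measurable W := Finset.measurable_fun_sum _ fun j _ => h.measurable _
  have lU : MemLp U 2 μ := memLp_finsetSum _ fun j _ => h.memLp_blockSum _ _ _ j
  have lV : MemLp V 2 μ := memLp_finsetSum _ fun j _ => h.memLp_blockSum _ _ _ j
  have lW : MemLp W 2 μ := memLp_finsetSum _ fun j _ => h.memLp _ _
  have hdec (ω : Ω) : ∑ s ∈ Finset.range T, Y s ω = U ω + V ω + W ω :=
    sum_range_eq_blockSum Y k L T ω
  simp only [hdec]
  have eU : ∫ ω, U ω ^ 2 ∂μ = N * ∫ ω, (∑ i ∈ Finset.range k, Y i ω) ^ 2 ∂μ :=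
    h.integral_sq_sum_blockSum 0 le_rfl N
  -- The small blocks are independent as well: the big blocks between them have length k ≥ L.
  have eV : ∫ ω, V ω ^ 2 ∂μ = N * ∫ ω, (∑ i ∈ Finset.range L, Y i ω) ^ 2 ∂μ :=
    h.integral_sq_sum_blockSum k (by omega) N
  have hNK : (N : ℝ) * K ≤ T := by exact_mod_cast Nat.div_mul_le_self T K
  have b1 : ‖∫ ω, Complex.exp ((a * (U ω + V ω + W ω) : ℝ) * Complex.I) ∂μ
      - ∫ ω, Complex.exp ((a * (U ω + V ω) : ℝ) * Complex.I) ∂μ‖ ≤ K * |B| * a := by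
    have e (ω : Ω) : a * (U ω + V ω + W ω) - a * (U ω + V ω) = a * W ω := by ring
    refine (norm_integral_exp_sub_le_integral (((mU.add mV).add mW).const_mul a)
      ((mU.add mV).const_mul a) ?_).trans ?_
    · simp only [Pi.add_apply, e]
      exact (lW.integrable (by simp)).const_mul a
    · simp only [Pi.add_apply, e]
      have hb (ω : Ω) : |a * W ω| ≤ K * |B| * a := by
        rw [abs_mul, abs_of_nonneg ha0, mul_comm]
        refine mul_le_mul_of_nonneg_right ?_ ha0
        calc |W ω| ≤ ∑ i ∈ Finset.range (T % K), |Y (N * K + i) ω| := Finset.abs_sum_le_sum_abs _ _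
          _ ≤ ∑ i ∈ Finset.range (T % K), |B| :=
            Finset.sum_le_sum fun i _ => (h.abs_le _ _).trans (le_abs_self B)
          _ = (T % K : ℕ) * |B| := by simp
          _ ≤ K * |B| := by
            have : T % K ≤ K := (Nat.mod_lt _ (by omega)).le
            gcongr
      calc ∫ ω, |a * W ω| ∂μ ≤ ∫ ω, K * |B| * a ∂μ :=
            integral_mono ((lW.integrable (by simp)).const_mul a).abs (integrable_const _) hb
        _ = K * |B| * a := by simp
  have b2 : ‖∫ ω, Complex.exp ((a * (U ω + V ω) : ℝ) * Complex.I) ∂μ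
      - ∫ ω, Complex.exp ((a * U ω : ℝ) * Complex.I) ∂μ‖
      ≤ √((∫ ω, (∑ i ∈ Finset.range L, Y i ω) ^ 2 ∂μ) / K) := by
    have e (ω : Ω) : a * (U ω + V ω) - a * U ω = a * V ω := by ring
    refine (norm_integral_exp_sub_le_sqrt ((mU.add mV).const_mul a) (mU.const_mul a) ?_).trans ?_
    · simp only [Pi.add_apply, e]
      exact lV.const_mul a
    · simp only [Pi.add_apply, e, mul_pow]
      rw [integral_const_mul, eV, hasq]
      refine Real.sqrt_le_sqrt ?_
      have hI : 0 ≤ ∫ ω, (∑ i ∈ Finset.range L, Y i ω) ^ 2 ∂μ :=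
        integral_nonneg fun _ => sq_nonneg _
      rw [← mul_assoc, div_eq_inv_mul]
      refine mul_le_mul_of_nonneg_right ?_ hI
      rw [inv_mul_eq_div, div_le_iff₀ hT0, inv_mul_eq_div, le_div_iff₀ hK0]
      exact hNK
  have b3 : ‖∫ ω, Complex.exp ((a * U ω : ℝ) * Complex.I) ∂μ
      - ∫ ω, Complex.exp (((√(K : ℝ))⁻¹ * ((√(N : ℝ))⁻¹ * U ω) : ℝ) * Complex.I) ∂μ‖
      ≤ |√((N : ℝ) / T) - (√(K : ℝ))⁻¹| * √(∫ ω, (∑ i ∈ Finset.range k, Y i ω) ^ 2 ∂μ) := by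
    have e (ω : Ω) : a * U ω - (√(K : ℝ))⁻¹ * ((√(N : ℝ))⁻¹ * U ω)
        = (a - (√(K : ℝ))⁻¹ * (√(N : ℝ))⁻¹) * U ω := by ring
    refine (norm_integral_exp_sub_le_sqrt (mU.const_mul a) ((mU.const_mul _).const_mul _)
      ?_).trans ?_
    · simp only [e]
      exact lU.const_mul _
    · simp only [e, mul_pow]
      rw [integral_const_mul, eU, ← mul_assoc, Real.sqrt_mul (by positivity),
        Real.sqrt_mul (sq_nonneg _), Real.sqrt_sq_eq_abs]
      refine mul_le_mul_of_nonneg_right ?_ (Real.sqrt_nonneg _)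
      rcases Nat.eq_zero_or_pos N with h0 | h0
      · simp [h0]
      · have hN0 : (√(N : ℝ)) ≠ 0 := by positivity
        refine le_of_eq ?_
        nth_rw 2 [← abs_of_nonneg (Real.sqrt_nonneg (N : ℝ))]
        rw [← abs_mul, sub_mul, mul_assoc, inv_mul_cancel₀ hN0, mul_one, ha,
          Real.sqrt_div (Nat.cast_nonneg _), inv_mul_eq_div]
  calc _ ≤ _ := norm_sub_le_norm_sub_add_norm_sub _
        (∫ ω, Complex.exp ((a * U ω : ℝ) * Complex.I) ∂μ) _
    _ ≤ _ := add_le_add ((norm_sub_le_norm_sub_add_norm_sub _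
        (∫ ω, Complex.exp ((a * (U ω + V ω) : ℝ) * Complex.I) ∂μ) _).trans (add_le_add b1 b2)) b3

/-- **Central limit theorem** for bounded stationary `m`-dependent sequences, in terms of
characteristic functions. -/
theorem tendsto_integral_exp (h : IsMDependent μ Y B L) :
    Tendsto (fun T : ℕ => ∫ ω, Complex.exp (((√(T : ℝ))⁻¹ * ∑ s ∈ Finset.range T, Y s ω : ℝ)
      * Complex.I) ∂μ) atTop (𝓝 (Complex.exp (-(longRunVar μ Y L : ℂ) / 2))) := by
  set A := ∫ ω, (∑ i ∈ Finset.range L, Y i ω) ^ 2 ∂μ with hA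
  set σ := longRunVar μ Y L with hσ
  have hcast : Tendsto (fun m : ℕ => ((L + m + L : ℕ) : ℝ)) atTop atTop := by
    refine tendsto_natCast_atTop_atTop.comp (tendsto_atTop_mono (fun m => ?_) tendsto_id)
    simp only [id]
    omega
  have lim1 : Tendsto (fun m : ℕ => √(A / ((L + m + L : ℕ) : ℝ))) atTop (𝓝 0) := by
    simpa using (hcast.const_div_atTop A).sqrt
  have lim2 : Tendsto (fun m : ℕ => (∫ ω, (∑ i ∈ Finset.range (L + m), Y i ω) ^ 2 ∂μ)
      / ((L + m + L : ℕ) : ℝ)) atTop (𝓝 σ) := by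
    -- With k = L + m the variance of a big block is A + mσ = σ(L + m + L) + (A - 2Lσ), by
    -- `integral_sq_sum_add`.
    have e : ∀ᶠ m : ℕ in atTop, σ + (A - 2 * L * σ) / ((L + m + L : ℕ) : ℝ)
        = (∫ ω, (∑ i ∈ Finset.range (L + m), Y i ω) ^ 2 ∂μ) / ((L + m + L : ℕ) : ℝ) := by
      filter_upwards [eventually_gt_atTop 0] with m hm
      rw [h.integral_sq_sum_add]
      field_simp
      push_cast
      ring
    refine Tendsto.congr' e ?_
    simpa using (hcast.const_div_atTop (A - 2 * L * σ)).const_add σ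
  have lim3 : Tendsto (fun m : ℕ =>
      ‖Complex.exp (-(((∫ ω, (∑ i ∈ Finset.range (L + m), Y i ω) ^ 2 ∂μ)
        / (L + m + L : ℕ) : ℝ) : ℂ) / 2) - Complex.exp (-(σ : ℂ) / 2)‖) atTop (𝓝 0) := by
    rw [← tendsto_iff_norm_sub_tendsto_zero]
    exact (by fun_prop : Continuous fun r : ℝ =>
      Complex.exp (-(r : ℂ) / 2)).continuousAt.tendsto.comp lim2
  rw [Metric.tendsto_nhds]
  intro ε hε
  -- There are four errors. The small blocks and the variance defect are made small by the block
  -- length, uniformly in T; with the block length fixed, the remaining two vanish as T → ∞.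
  have hε4 : 0 < ε / 4 := by positivity
  obtain ⟨m, hm1, hm3, hm0⟩ := ((lim1.eventually_lt_const hε4).and
    ((lim3.eventually_lt_const hε4).and (eventually_gt_atTop 0))).exists
  set k := L + m with hk
  have hK0 : 0 < k + L := by omega
  have hdiv : Tendsto (fun T : ℕ => T / (k + L)) atTop atTop := Nat.tendsto_div_const_atTop hK0.ne'
  have big := (h.tendsto_integral_exp_bigBlocks k).comp hdiv
  rw [tendsto_iff_norm_sub_tendsto_zero] at big
  have hsq : Tendsto (fun T : ℕ => (√(T : ℝ))⁻¹) atTop (𝓝 0) :=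
    tendsto_inv_atTop_zero.comp (Real.tendsto_sqrt_atTop.comp tendsto_natCast_atTop_atTop)
  have hrem : Tendsto (fun T : ℕ => ((k + L : ℕ) : ℝ) * |B| * (√(T : ℝ))⁻¹
      + |√(((T / (k + L) : ℕ) : ℝ) / T) - (√((k + L : ℕ) : ℝ))⁻¹|
        * √(∫ ω, (∑ i ∈ Finset.range k, Y i ω) ^ 2 ∂μ)) atTop (𝓝 0) := by
    have h1 : Tendsto (fun T : ℕ => ((T / (k + L) : ℕ) : ℝ) / T) atTop (𝓝 ((k + L : ℕ) : ℝ)⁻¹) := by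
      have := (tendsto_nat_floor_mul_div_atTop (R := ℝ) (a := ((k + L : ℕ) : ℝ)⁻¹)
        (by positivity)).comp tendsto_natCast_atTop_atTop
      refine this.congr fun T => ?_
      simp only [Function.comp]
      rw [inv_mul_eq_div, Nat.floor_div_eq_div]
    have h2 := ((h1.sqrt.sub_const (√((k + L : ℕ) : ℝ))⁻¹).abs).mul_const
      √(∫ ω, (∑ i ∈ Finset.range k, Y i ω) ^ 2 ∂μ)
    rw [Real.sqrt_inv, sub_self, abs_zero, zero_mul] at h2
    simpa using (hsq.const_mul (((k + L : ℕ) : ℝ) * |B|)).add h2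
  filter_upwards [big.eventually_lt_const hε4, hrem.eventually_lt_const hε4, eventually_gt_atTop 0]
    with T t1 t2 hT
  have b := h.norm_integral_exp_sub_bigBlocks_le (k := k) (by omega) (by omega) hT
  rw [dist_eq_norm]
  simp only [Function.comp] at t1
  have s1 := norm_sub_le_norm_sub_add_norm_sub
    (∫ ω, Complex.exp (((√(T : ℝ))⁻¹ * ∑ s ∈ Finset.range T, Y s ω : ℝ) * Complex.I) ∂μ)
    (∫ ω, Complex.exp (((√((k + L : ℕ) : ℝ))⁻¹ * ((√((T / (k + L) : ℕ) : ℝ))⁻¹ *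
        ∑ j ∈ Finset.range (T / (k + L)), blockSum Y (k + L) 0 k j ω) : ℝ) * Complex.I) ∂μ)
    (Complex.exp (-(σ : ℂ) / 2))
  have s2 := norm_sub_le_norm_sub_add_norm_sub
    (∫ ω, Complex.exp (((√((k + L : ℕ) : ℝ))⁻¹ * ((√((T / (k + L) : ℕ) : ℝ))⁻¹ *
        ∑ j ∈ Finset.range (T / (k + L)), blockSum Y (k + L) 0 k j ω) : ℝ) * Complex.I) ∂μ)
    (Complex.exp (-(((∫ ω, (∑ i ∈ Finset.range k, Y i ω) ^ 2 ∂μ) / (k + L : ℕ) : ℝ) : ℂ) / 2))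
    (Complex.exp (-(σ : ℂ) / 2))
  linarith

end IsMDependent

/-! ### Stationary laws -/

section Stationary

variable {E : Type*} [MeasurableSpace E]

lemma measurable_shift (t : ℤ) : Measurable (shift t : (ℤ → E) → ℤ → E) :=
  measurable_pi_lambda _ fun _ => measurable_pi_apply _

/-- A shift-invariant law is its own stationary law. -/
lemma stationaryLaw_eq_self {p : Measure (ℤ → E)} (hp : ∀ t : ℤ, p.map (shift t) = p) :
    stationaryLaw p = p := by
  have hlim (S : Set (ℤ → E)) (hS : MeasurableSet S) :
      Tendsto (fun T : ℕ => (T : ℝ≥0∞)⁻¹ * ∑ t ∈ Finset.Icc 1 T, p {x | shift (t : ℤ) x ∈ S})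
        atTop (𝓝 (p S)) := by
    refine tendsto_const_nhds.congr' ?_
    filter_upwards [eventually_gt_atTop 0] with T hT
    have e (t : ℕ) : p {x | shift (t : ℤ) x ∈ S} = p S := by
      conv_rhs => rw [← hp t, Measure.map_apply (measurable_shift _) hS]
      rfl
    simp only [e, Finset.sum_const, Nat.card_Icc, Nat.add_sub_cancel, nsmul_eq_mul]
    rw [← mul_assoc, ENNReal.inv_mul_cancel (by simpa using hT.ne') (by simp), one_mul]
  have hex : ∃ pbar, IsStationaryLaw p pbar := ⟨p, hlim⟩
  rw [stationaryLaw, dif_pos hex]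
  ext S hS
  exact tendsto_nhds_unique (hex.choose_spec S hS) (hlim S hS)

lemma infinitePi_map_shift (γ : Measure E) [IsProbabilityMeasure γ] (t : ℤ) :
    (Measure.infinitePi fun _ : ℤ => γ).map (shift t) = Measure.infinitePi fun _ => γ :=
  Measure.map_infinitePi_infinitePi_of_inj (P := fun _ : ℤ => γ) (f := fun s => s + t)
    (add_left_injective t)

end Stationary

/-! ### White noise and the centered block indicators -/

lemma normalLaw_zero_one {ι : Type*} [Fintype ι] [DecidableEq ι] :
    normalLaw 0 (1 : Matrix ι ι ℝ) = Measure.pi fun _ => gaussianReal 0 1 := by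
  rw [normalLaw, WithLp.toLp_zero, multivariateGaussian_zero_one, ← map_pi_eq_stdGaussian,
    Measure.map_map (by fun_prop) (by fun_prop)]
  exact Measure.map_id

/-- The law of a sequence of independent standard normal vectors. -/
noncomputable abbrev whiteNoise (D : ℕ) : Measure (ℤ → Fin D → ℝ) :=
  Measure.infinitePi fun _ => normalLaw 0 1

section WhiteNoise

variable {D L I : ℕ}

lemma measurable_block (L : ℕ) (t : ℤ) :
    Measurable fun e : ℤ → Fin D → ℝ => block L e t :=
  measurable_pi_lambda _ fun k =>
    (measurable_pi_apply k.2).comp (measurable_pi_apply (t + (k.1 : ℕ)))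

lemma measurable_blockInd (r : Fin L × Fin D → ℝ) (t : ℤ) :
    Measurable fun e : ℤ → Fin D → ℝ => blockInd r e t := by
  have : MeasurableSet {e : ℤ → Fin D → ℝ | block L e t ≤ r} :=
    measurableSet_Iic.preimage (measurable_block L t)
  exact Measurable.ite this measurable_const measurable_const

/-- Uncurried, white noise is a family of independent standard normal scalars indexed by `ℤ × Fin
D`, and a block reads it along an injective map of indices. -/
lemma map_block_whiteNoise (L : ℕ) (t : ℤ) :
    (whiteNoise D).map (fun e => block L e t) = normalLaw 0 1 := by
  have h1 := Measure.infinitePi_map_curry_symm (fun (_ : ℤ) (_ : Fin D) => gaussianReal 0 1)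
  have hinj : Function.Injective fun k : Fin L × Fin D => (t + ((k.1 : ℕ) : ℤ), k.2) := by
    rintro ⟨a, b⟩ ⟨c, d⟩ h
    simp only [Prod.mk.injEq, add_right_inj, Nat.cast_inj] at h
    exact Prod.ext (Fin.ext h.1) h.2
  have h2 := Measure.map_infinitePi_infinitePi_of_inj
    (P := fun _ : ℤ × Fin D => gaussianReal 0 1) hinj
  rw [← h1, Measure.map_map (by fun_prop) (MeasurableEquiv.measurable _)] at h2
  simp only [Measure.infinitePi_eq_pi] at h2
  rw [normalLaw_zero_one, ← h2, whiteNoise]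
  simp only [normalLaw_zero_one]
  rfl

lemma blockInd_shift (r : Fin L × Fin D → ℝ) (e : ℤ → Fin D → ℝ) (s t : ℤ) :
    blockInd r (shift s e) t = blockInd r e (t + s) := by
  have : block L (shift s e) t = block L e (t + s) := by
    ext k
    simp only [block, shift]
    congr 1
    ring
  rw [blockInd, blockInd, this]

lemma blockInd_congr (r : Fin L × Fin D → ℝ) {e e' : ℤ → Fin D → ℝ} {t : ℤ}
    (h : ∀ s, t ≤ s → s < t + L → e s = e' s) : blockInd r e t = blockInd r e' t := by
  have : block L e t = block L e' t := by
    ext k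
    simp only [block]
    rw [h _ (by omega) (by omega)]
  rw [blockInd, blockInd, this]

/-- The centered indicators `ξ_t - u_⋆`. -/
noncomputable def centeredInd (ρ : Fin I → Fin L × Fin D → ℝ) (t : ℤ) (e : ℤ → Fin D → ℝ) :
    Fin I → ℝ :=
  fun i => xi ρ e t i - uStar ρ i

variable (ρ : Fin I → Fin L × Fin D → ℝ)

lemma measurable_centeredInd (t : ℤ) : Measurable (centeredInd ρ t) :=
  measurable_pi_lambda _ fun i => (measurable_blockInd (ρ i) t).sub_const _

lemma centeredInd_shift (s t : ℤ) (e : ℤ → Fin D → ℝ) :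
    centeredInd ρ t (shift s e) = centeredInd ρ (t + s) e := by
  ext i
  simp only [centeredInd, xi, blockInd_shift]

lemma abs_centeredInd_le (t : ℤ) (e : ℤ → Fin D → ℝ) (i : Fin I) : |centeredInd ρ t e i| ≤ 1 := by
  have h1 : 0 ≤ uStar ρ i := measureReal_nonneg
  have h2 : uStar ρ i ≤ 1 := measureReal_le_one
  simp only [centeredInd, xi, blockInd]
  split_ifs <;> rw [abs_le] <;> constructor <;> linarith

lemma memLp_centeredInd (t : ℤ) (i : Fin I) (p : ℝ≥0∞) :
    MemLp (fun e => centeredInd ρ t e i) p (whiteNoise D) :=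
  MemLp.of_bound ((measurable_pi_apply i).comp (measurable_centeredInd ρ t)).aestronglyMeasurable 1
    (ae_of_all _ fun e => abs_centeredInd_le ρ t e i)

lemma integral_centeredInd (t : ℤ) (i : Fin I) :
    ∫ e, centeredInd ρ t e i ∂(whiteNoise D) = 0 := by
  have hm : MeasurableSet {e : ℤ → Fin D → ℝ | block L e t ≤ ρ i} :=
    measurableSet_Iic.preimage (measurable_block L t)
  have hind : (fun e => blockInd (ρ i) e t)
      = Set.indicator {e : ℤ → Fin D → ℝ | block L e t ≤ ρ i} 1 := by
    ext e
    by_cases h : block L e t ≤ ρ i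
    · rw [Set.indicator_of_mem (show e ∈ {e | block L e t ≤ ρ i} from h), blockInd, if_pos h]
      rfl
    · rw [Set.indicator_of_notMem (show e ∉ {e | block L e t ≤ ρ i} from h), blockInd, if_neg h]
  have hint : Integrable (fun e => blockInd (ρ i) e t) (whiteNoise D) := by
    rw [hind]
    exact (integrable_const 1).indicator hm
  have hval : ∫ e, blockInd (ρ i) e t ∂(whiteNoise D) = uStar ρ i := by
    rw [hind, integral_indicator_one hm, uStar, normalCDF, ← map_block_whiteNoise (D := D) L t,
      map_measureReal_apply (measurable_block L t) measurableSet_Iic]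
    rfl
  simp only [centeredInd, xi]
  rw [integral_sub hint (integrable_const _), hval]
  simp

lemma identDistrib_centeredInd (k : ℤ) :
    IdentDistrib (fun e (s : ℤ) => centeredInd ρ (k + s) e) (fun e (s : ℤ) => centeredInd ρ s e)
      (whiteNoise D) (whiteNoise D) := by
  have hm : Measurable fun (e : ℤ → Fin D → ℝ) (s : ℤ) => centeredInd ρ s e :=
    measurable_pi_lambda _ fun s => measurable_centeredInd ρ s
  have h : IdentDistrib (shift k) id (whiteNoise D) (whiteNoise D) :=
    ⟨(measurable_shift k).aemeasurable, aemeasurable_id, by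
      rw [Measure.map_id]; exact infinitePi_map_shift _ k⟩
  have hc := h.comp hm
  rw [Function.comp_id] at hc
  convert hc using 1
  ext1 e
  simp only [Function.comp, centeredInd_shift]
  ext1 s
  rw [add_comm]

/-- The indicators before time a read errors at times below a + L only, and those from a + L on read
no earlier error. Starting at a + L rather than a + L - 1 avoids a truncated subtraction when L = 0.
-/
lemma indepFun_centeredInd (a : ℕ) :
    IndepFun (fun e (s : Fin a) => centeredInd ρ (s : ℕ) e)
      (fun e (s : ℕ) => centeredInd ρ (a + L + s : ℕ) e) (whiteNoise D) := by
  classical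
  have hi : iIndepFun (fun (t : ℤ) (e : ℤ → Fin D → ℝ) => e t) (whiteNoise D) :=
    iIndepFun_infinitePi (P := fun _ : ℤ => normalLaw 0 (1 : Matrix (Fin D) (Fin D) ℝ))
      (X := fun _ => id) (fun _ => measurable_id)
  have hd := indepFun_of_disjoint hi (fun t => (measurable_pi_apply t).aemeasurable)
    (S := {t : ℤ | t < a + L}) (T := {t : ℤ | (a : ℤ) + L ≤ t})
    (Set.disjoint_left.2 fun t h1 h2 => by
      simp only [Set.mem_ofPred_eq] at h1 h2
      omega)
  -- A partial path is extended by 0 so that `centeredInd` can be applied to it; by `blockInd_congr`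
  -- the artificial values are never read.
  let ext (S : Set ℤ) (f : S → Fin D → ℝ) : ℤ → Fin D → ℝ :=
    fun t => if h : t ∈ S then f ⟨t, h⟩ else 0
  have hext (S : Set ℤ) : Measurable (ext S) := by
    refine measurable_pi_lambda _ fun t => ?_
    by_cases h : t ∈ S
    · simpa only [ext, h, dite_true] using measurable_pi_apply _
    · simpa only [ext, h, dite_false] using measurable_const
  have key := hd.comp (φ := fun f (s : Fin a) => centeredInd ρ (s : ℕ) (ext _ f))
    (ψ := fun f (s : ℕ) => centeredInd ρ (a + L + s : ℕ) (ext _ f))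
    (measurable_pi_lambda _ fun s => (measurable_centeredInd ρ _).comp (hext _))
    (measurable_pi_lambda _ fun s => (measurable_centeredInd ρ _).comp (hext _))
  convert key using 1
  · ext e s i
    simp only [Function.comp, centeredInd, xi]
    congr 1
    refine blockInd_congr _ fun t h1 h2 => ?_
    have : t ∈ {t : ℤ | t < a + L} := by
      have := s.2
      simp only [Set.mem_ofPred_eq]
      omega
    simp only [ext, this, dite_true]
  · ext e s i
    simp only [Function.comp, centeredInd, xi]
    congr 1
    refine blockInd_congr _ fun t h1 h2 => ?_
    have : t ∈ {t : ℤ | (a : ℤ) + L ≤ t} := by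
      simp only [Set.mem_ofPred_eq]
      push_cast at h1
      omega
    simp only [ext, this, dite_true]

/-- This is the scalar input for the Cramér–Wold argument. -/
lemma isMDependent_centeredInd (a : Fin I → ℝ) :
    IsMDependent (whiteNoise D) (fun (s : ℕ) e => a ⬝ᵥ centeredInd ρ s e) (∑ i, |a i|) L where
  measurable s := by
    have := measurable_centeredInd ρ s
    exact (by fun_prop : Measurable fun z : Fin I → ℝ => a ⬝ᵥ z).comp this
  abs_le s e := by
    refine (Finset.abs_sum_le_sum_abs _ _).trans (Finset.sum_le_sum fun i _ => ?_)
    rw [abs_mul]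
    exact mul_le_of_le_one_right (abs_nonneg _) (abs_centeredInd_le ρ _ _ _)
  integral_eq_zero s := by
    simp only [dotProduct]
    rw [integral_finsetSum _ fun i _ =>
      ((memLp_centeredInd ρ s i 1).integrable le_rfl).const_mul _]
    refine Finset.sum_eq_zero fun i _ => ?_
    rw [integral_const_mul, integral_centeredInd, mul_zero]
  stationary k := by
    have := (identDistrib_centeredInd ρ k).comp
      (u := fun f (s : ℕ) => a ⬝ᵥ f (s : ℤ)) (by fun_prop)
    simpa [Function.comp_def] using this
  indep n := (indepFun_centeredInd ρ n).comp (φ := fun f s => a ⬝ᵥ f s) (ψ := fun f s => a ⬝ᵥ f s)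
    (by fun_prop) (by fun_prop)

end WhiteNoise

/-! ### The long-run covariance matrix -/

section LongRunCov

variable {D L I : ℕ} (ρ : Fin I → Fin L × Fin D → ℝ)

lemma lagCov_apply (τ : ℤ) (i j : Fin I) : lagCov (whiteNoise D) ρ τ i j
    = ∫ e, centeredInd ρ τ e i * centeredInd ρ 0 e j ∂(whiteNoise D) := by
  rw [lagCov, of_apply, stationaryMean, stationaryLaw_eq_self fun t => infinitePi_map_shift _ t]
  rfl

/-- Stationarity: both times are shifted by τ. -/
lemma lagCov_neg (τ : ℤ) :
    lagCov (whiteNoise D) ρ (-τ) = (lagCov (whiteNoise D) ρ τ)ᵀ := by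
  ext i j
  rw [transpose_apply, lagCov_apply, lagCov_apply]
  have h := ((identDistrib_centeredInd ρ τ).comp
    (u := fun f : ℤ → Fin I → ℝ => f (-τ) i * f 0 j) (by fun_prop)).integral_eq
  simp only [Function.comp, add_neg_cancel, add_zero] at h
  rw [← h]
  simp only [mul_comm]

lemma lagCov_eq_zero {τ : ℤ} (hτ : (L : ℤ) < τ) : lagCov (whiteNoise D) ρ τ = 0 := by
  ext i j
  obtain ⟨d, hd⟩ : ∃ d : ℕ, ((1 + L + d : ℕ) : ℤ) = τ := ⟨(τ - 1 - L).toNat, by omega⟩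
  have hφ : Measurable fun f : Fin 1 → Fin I → ℝ => f 0 j := by fun_prop
  have hψ : Measurable fun f : ℕ → Fin I → ℝ => f d i := by fun_prop
  have h := ((indepFun_centeredInd ρ 1).comp hφ hψ).symm.integral_mul_eq_mul_integral
    (memLp_centeredInd ρ _ i 1).aestronglyMeasurable
    (memLp_centeredInd ρ _ j 1).aestronglyMeasurable
  rw [lagCov_apply, ← hd]
  refine h.trans ?_
  have h0 := integral_centeredInd ρ ((1 + L + d : ℕ) : ℤ) i
  simp only [Function.comp_def]
  rw [h0, zero_mul, Matrix.zero_apply]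

/-- The series is a finite sum, since lags beyond L vanish in both directions; negative lags are
transposes of positive ones. -/
lemma longRunCov_eq : longRunCov (whiteNoise D) ρ = lagCov (whiteNoise D) ρ 0
    + ∑ d ∈ Finset.range L, (lagCov (whiteNoise D) ρ ((d + 1 : ℕ) : ℤ)
      + (lagCov (whiteNoise D) ρ ((d + 1 : ℕ) : ℤ))ᵀ) := by
  ext i j
  have h1 : HasSum (fun n : ℕ => lagCov (whiteNoise D) ρ (n : ℤ) i j)
      (∑ n ∈ Finset.range (L + 1), lagCov (whiteNoise D) ρ (n : ℤ) i j) :=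
    hasSum_sum_of_ne_finset_zero fun n hn => by
      rw [lagCov_eq_zero ρ (by rw [Finset.mem_range] at hn; omega), Matrix.zero_apply]
  have h2 : HasSum (fun n : ℕ => lagCov (whiteNoise D) ρ (-((n : ℤ) + 1)) i j)
      (∑ n ∈ Finset.range L, lagCov (whiteNoise D) ρ (-((n : ℤ) + 1)) i j) :=
    hasSum_sum_of_ne_finset_zero fun n hn => by
      rw [lagCov_neg, lagCov_eq_zero ρ (by rw [Finset.mem_range] at hn; omega), transpose_zero,
        Matrix.zero_apply]
  have h3 : HasSum (fun τ : ℤ => lagCov (whiteNoise D) ρ τ i j) _ :=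
    HasSum.of_nat_of_neg_add_one h1 h2
  rw [longRunCov, of_apply, h3.tsum_eq, Finset.sum_range_succ',
    Matrix.add_apply, Matrix.sum_apply]
  simp only [Matrix.add_apply, Finset.sum_add_distrib, lagCov_neg, Nat.cast_add, Nat.cast_one,
    Nat.cast_zero]
  ring

lemma lagCov_zero_transpose :
    (lagCov (whiteNoise D) ρ 0)ᵀ = lagCov (whiteNoise D) ρ 0 := by
  rw [← lagCov_neg, neg_zero]

lemma autocov_eq_dotProduct (a : Fin I → ℝ) (d : ℕ) :
    autocov (whiteNoise D) (fun (s : ℕ) e => a ⬝ᵥ centeredInd ρ s e) d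
      = a ⬝ᵥ lagCov (whiteNoise D) ρ d *ᵥ a := by
  have hint (i j : Fin I) : Integrable
      (fun e => a i * (centeredInd ρ (d : ℤ) e i * centeredInd ρ 0 e j) * a j) (whiteNoise D) :=
    (((memLp_centeredInd ρ d i 2).integrable_mul (memLp_centeredInd ρ 0 j 2)).const_mul
      (a i)).mul_const (a j)
  have e (e : ℤ → Fin D → ℝ) : a ⬝ᵥ centeredInd ρ (d : ℤ) e * a ⬝ᵥ centeredInd ρ ((0 : ℕ) : ℤ) e
      = ∑ i, ∑ j, a i * (centeredInd ρ (d : ℤ) e i * centeredInd ρ 0 e j) * a j := by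
    simp only [dotProduct, Finset.sum_mul_sum, Nat.cast_zero]
    refine Finset.sum_congr rfl fun i _ => Finset.sum_congr rfl fun j _ => ?_
    ring
  rw [autocov]
  simp only [e]
  rw [integral_finsetSum _ fun i _ => integrable_finsetSum _ fun j _ => hint i j]
  simp only [dotProduct, mulVec, Finset.mul_sum]
  refine Finset.sum_congr rfl fun i _ => ?_
  rw [integral_finsetSum _ fun j _ => hint i j]
  refine Finset.sum_congr rfl fun j _ => ?_
  rw [integral_mul_const, integral_const_mul, lagCov_apply, mul_assoc]

/-- A matrix and its transpose have the same quadratic form, which accounts for the factor 2 in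
`longRunVar`. -/
lemma longRunVar_eq_dotProduct (a : Fin I → ℝ) :
    longRunVar (whiteNoise D) (fun (s : ℕ) e => a ⬝ᵥ centeredInd ρ s e) L
      = a ⬝ᵥ longRunCov (whiteNoise D) ρ *ᵥ a := by
  rw [longRunVar, longRunCov_eq, add_mulVec, dotProduct_add, sum_mulVec, dotProduct_sum,
    Finset.mul_sum, autocov_eq_dotProduct]
  congr 1
  refine Finset.sum_congr rfl fun d _ => ?_
  rw [autocov_eq_dotProduct, add_mulVec, dotProduct_add, dotProduct_transpose_mulVec, two_mul]

/-- Nonnegativity is read off the central limit theorem: exp(-aᵀΣa / 2) is a limit of characteristic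
functions, so its modulus is at most 1. -/
lemma posSemidef_longRunCov : (longRunCov (whiteNoise D) ρ).PosSemidef := by
  refine .of_dotProduct_mulVec_nonneg ?_ fun a => ?_
  · rw [IsHermitian, conjTranspose_eq_transpose_of_trivial, longRunCov_eq, transpose_add,
      lagCov_zero_transpose, transpose_sum]
    simp only [transpose_add, transpose_transpose, add_comm]
  · rw [star_trivial, ← longRunVar_eq_dotProduct]
    have h := (isMDependent_centeredInd ρ a).tendsto_integral_exp.norm
    have h1 : ‖Complex.exp (-(longRunVar (whiteNoise D)
        (fun (s : ℕ) e => a ⬝ᵥ centeredInd ρ s e) L : ℂ) / 2)‖ ≤ 1 := by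
      refine le_of_tendsto' h fun T => (norm_integral_le_integral_norm _).trans ?_
      simp only [Complex.norm_exp_ofReal_mul_I]
      simp
    rw [Complex.norm_exp, Real.exp_le_one_iff, ← Complex.ofReal_neg] at h1
    have h2 : ((((-longRunVar (whiteNoise D)
        (fun (s : ℕ) e => a ⬝ᵥ centeredInd ρ s e) L : ℝ) : ℂ) / 2).re)
        = -longRunVar (whiteNoise D) (fun (s : ℕ) e => a ⬝ᵥ centeredInd ρ s e) L / 2 := by simp
    rw [h2] at h1
    linarith

end LongRunCov

/-- If `X ∼ N(0, S)` with `S` invertible, then `Xᵀ S⁻¹ X` has a chi-squared law. -/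
lemma multivariateGaussian_map_quadratic {I : ℕ} {S : Matrix (Fin I) (Fin I) ℝ}
    (hS : S.PosSemidef) (hu : IsUnit S) :
    (multivariateGaussian 0 S).map (fun x => x.ofLp ⬝ᵥ S⁻¹ *ᵥ x.ofLp) = chiSquared I := by
  have hs : CFC.sqrt S * CFC.sqrt S = S := CFC.sqrt_mul_sqrt_self _ hS.nonneg
  have ht : (CFC.sqrt S)ᵀ = CFC.sqrt S := by
    simpa [IsSelfAdjoint, star_eq_conjTranspose] using (CFC.sqrt_nonneg S).isSelfAdjoint
  have hdet : IsUnit (CFC.sqrt S).det := by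
    have := (isUnit_iff_isUnit_det _).1 hu
    rw [← hs, det_mul] at this
    exact isUnit_of_mul_isUnit_left this
  have hinv : CFC.sqrt S * S⁻¹ * CFC.sqrt S = 1 := by
    nth_rw 2 [← hs]
    rw [Matrix.mul_inv_rev, Matrix.mul_assoc, Matrix.mul_assoc, nonsing_inv_mul _ hdet,
      Matrix.mul_one, mul_nonsing_inv _ hdet]
  have hq : Continuous fun x : EuclideanSpace ℝ (Fin I) => x.ofLp ⬝ᵥ S⁻¹ *ᵥ x.ofLp := by fun_prop
  have hc : Continuous fun x => (0 : EuclideanSpace ℝ (Fin I)) +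
      toEuclideanCLM (𝕜 := ℝ) (CFC.sqrt S) x := by fun_prop
  -- N(0, S) is the law of S^{1/2} Z with Z standard normal, and S^{1/2} S⁻¹ S^{1/2} = 1 turns the
  -- quadratic form into |Z|².
  rw [multivariateGaussian, ← map_pi_eq_stdGaussian, Measure.map_map hq.measurable hc.measurable,
    Measure.map_map (hq.comp hc).measurable (by fun_prop), chiSquared]
  congr 1
  ext x
  simp only [Function.comp, zero_add, ofLp_toEuclideanCLM]
  have hx : S⁻¹ *ᵥ CFC.sqrt S *ᵥ x = (S⁻¹ * CFC.sqrt S) *ᵥ x := mulVec_mulVec ..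
  rw [hx, ← vecMul_transpose, ht, ← dotProduct_mulVec, mulVec_mulVec, ← Matrix.mul_assoc, hinv,
    one_mulVec, dotProduct]
  simp only [sq]

/-! ### Convergence of the normalized sums and of the statistic -/

section Convergence

variable {D L I : ℕ} (ρ : Fin I → Fin L × Fin D → ℝ)

/-- The normalized sum of the first `T` centered indicators. -/
noncomputable def normSum (T : ℕ) (e : ℤ → Fin D → ℝ) : EuclideanSpace ℝ (Fin I) :=
  WithLp.toLp 2 ((√(T : ℝ))⁻¹ • ∑ s ∈ Finset.range T, centeredInd ρ (s : ℤ) e)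

lemma measurable_normSum (T : ℕ) : Measurable (normSum ρ T) := by
  have h (s : ℤ) := measurable_centeredInd ρ s
  unfold normSum
  fun_prop

/-- Cramér–Wold: the characteristic function at a is that of the scalar sums in direction a,
evaluated at 1. -/
lemma tendstoInDistribution_normSum :
    TendstoInDistribution (normSum ρ) atTop (id : EuclideanSpace ℝ (Fin I) → _)
      (fun _ => whiteNoise D) (multivariateGaussian 0 (longRunCov (whiteNoise D) ρ)) where
  forall_aemeasurable T := (measurable_normSum ρ T).aemeasurable
  tendsto := by
    refine ProbabilityMeasure.tendsto_iff_tendsto_charFun.2 fun a => ?_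
    simp only [ProbabilityMeasure.coe_mk, Measure.map_id]
    rw [charFun_multivariateGaussian (posSemidef_longRunCov ρ)]
    have h := (isMDependent_centeredInd ρ a.ofLp).tendsto_integral_exp
    rw [longRunVar_eq_dotProduct] at h
    convert h using 2 with T
    · have hm : Measurable fun e : ℤ → Fin D → ℝ =>
          (√(T : ℝ))⁻¹ • ∑ s ∈ Finset.range T, centeredInd ρ (s : ℤ) e := by
        have h (s : ℤ) := measurable_centeredInd ρ s
        fun_prop
      refine (charFun_ofLp_eq hm.aemeasurable a).trans ?_
      simp only [dotProduct_smul, dotProduct_sum, smul_eq_mul]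
    · simp [neg_div]

/-- Shifting the path moves the window t - T + 1, …, t to 0, …, T - 1. The factor T and the two
factors 1/T combine into two factors 1/√T. For T = 0 both sides are 0. -/
lemma vStat_eq (S : Matrix (Fin I) (Fin I) ℝ) (e : ℤ → Fin D → ℝ) (t : ℤ) (T : ℕ) :
    vStat S ρ e t T = (normSum ρ T (shift (t - T + 1) e)).ofLp ⬝ᵥ
      S⁻¹ *ᵥ (normSum ρ T (shift (t - T + 1) e)).ofLp := by
  rcases Nat.eq_zero_or_pos T with rfl | hT
  · simp [vStat, normSum]
  have hT0 : (T : ℝ) ≠ 0 := by positivity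
  have hu : uEmp ρ e t T - uStar ρ
      = (T : ℝ)⁻¹ • ∑ s ∈ Finset.range T, centeredInd ρ (s : ℤ) (shift (t - T + 1) e) := by
    ext i
    simp only [centeredInd_shift, Pi.sub_apply, uEmp, empiricalCDF, Pi.smul_apply, smul_eq_mul,
      Finset.sum_apply]
    simp only [centeredInd, Finset.sum_sub_distrib, Finset.sum_const, Finset.card_range,
      nsmul_eq_mul, mul_sub, inv_mul_cancel_left₀ hT0, one_div, xi]
    congr 2
    refine (Finset.sum_bij (fun (s : ℕ) _ => (s : ℤ) + (t - T + 1)) ?_ ?_ ?_ ?_).symm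
    · intro s hs
      rw [Finset.mem_range] at hs
      rw [Finset.mem_Icc]
      omega
    · intro a _ b _ h
      simpa using h
    · intro b hb
      rw [Finset.mem_Icc] at hb
      exact ⟨(b - (t - T + 1)).toNat, by rw [Finset.mem_range]; omega, by omega⟩
    · intro s _
      rfl
  rw [vStat, hu, normSum]
  simp only [mulVec_smul, smul_dotProduct, dotProduct_smul, smul_eq_mul]
  have hsq : (√(T : ℝ))⁻¹ * (√(T : ℝ))⁻¹ = (T : ℝ)⁻¹ := by
    rw [← mul_inv, Real.mul_self_sqrt (Nat.cast_nonneg _)]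
  rw [mul_inv_cancel_left₀ hT0, ← mul_assoc, hsq]

end Convergence

lemma measurable_normError_path {n D : ℕ} (M : Model n D) :
    Measurable fun (f : ℤ → (Fin D → ℝ) × (Fin n → ℝ)) (t : ℤ) => M.normError (f t).1 (f t).2 :=
  measurable_pi_lambda _ fun t =>
    Model.IsSteadyState.measurable_normError.comp (measurable_pi_apply t)

end AttackDetection

theorem proposition1 {n D : ℕ} (M : Model n D)
    -- the nominal system and the steady-state Kalman filter fed with its output
    {Ω₀ : Type*} [MeasurableSpace Ω₀] (μ₀ : Measure Ω₀) [IsProbabilityMeasure μ₀]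
    (x w : ℤ → Ω₀ → Fin n → ℝ) (v y : ℤ → Ω₀ → Fin D → ℝ) (xhat₀ : ℤ → Ω₀ → Fin n → ℝ)
    (hsys : M.IsSteadyState μ₀ x w v y xhat₀)
    -- the received signal and the filter fed with it, under nominal statistics
    {Ω : Type*} [MeasurableSpace Ω] (μ : Measure Ω) [IsProbabilityMeasure μ]
    (z : ℤ → Ω → Fin D → ℝ) (xhat : ℤ → Ω → Fin n → ℝ)
    (hfilter : M.IsFilter μ z xhat)
    (hnom : Model.IsNominal μ₀ y xhat₀ μ z xhat)
    -- the sample points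
    {L I : ℕ} (ρ : Fin I → Fin L × Fin D → ℝ)
    (hinv : IsUnit (longRunCov (μ₀.map (M.errorPath y xhat₀)) ρ)) :
    ∀ t : ℤ, TendstoInDistribution
      (fun (T : ℕ) ω =>
        vStat (longRunCov (μ₀.map (M.errorPath y xhat₀)) ρ) ρ (M.errorPath z xhat ω) t T)
      atTop (id : ℝ → ℝ) (fun _ => μ) (chiSquared I) := by
  intro t
  have hid : IdentDistrib (M.errorPath z xhat) (M.errorPath y xhat₀) μ μ₀ :=
    hnom.comp (measurable_normError_path M)
  rw [hsys.map_errorPath] at hinv ⊢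
  have hlaw : μ.map (M.errorPath z xhat) = whiteNoise D := by
    rw [hid.map_eq, hsys.map_errorPath]
  set S := longRunCov (whiteNoise D) ρ with hS
  have hq : Continuous fun x : EuclideanSpace ℝ (Fin I) => x.ofLp ⬝ᵥ S⁻¹ *ᵥ x.ofLp := by fun_prop
  have hcm := (tendstoInDistribution_normSum (D := D) ρ).continuous_comp hq
  have hmT (T : ℕ) : Measurable fun e : ℤ → Fin D → ℝ => vStat S ρ e t T := by
    simp only [vStat_eq]
    exact hq.measurable.comp ((measurable_normSum ρ T).comp (measurable_shift _))
  -- The shift t - T + 1 varies with T, so the paths do not form one fixed sequence; but each shift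
  -- preserves white noise, and convergence in distribution involves only the law for each T.
  have hmapT (T : ℕ) : μ.map (fun ω => vStat S ρ (M.errorPath z xhat ω) t T)
      = (whiteNoise D).map ((fun x => x.ofLp ⬝ᵥ S⁻¹ *ᵥ x.ofLp) ∘ normSum ρ T) := by
    have e : (fun ω => vStat S ρ (M.errorPath z xhat ω) t T)
        = (fun e => vStat S ρ e t T) ∘ M.errorPath z xhat := rfl
    rw [e, ← AEMeasurable.map_map_of_aemeasurable (hmT T).aemeasurable hid.aemeasurable_fst, hlaw]
    have hsh : (whiteNoise D).map (shift (t - T + 1)) = whiteNoise D := infinitePi_map_shift _ _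
    conv_rhs => rw [← hsh,
      Measure.map_map (hq.measurable.comp (measurable_normSum ρ T)) (measurable_shift _)]
    congr 1
    ext e
    exact vStat_eq ρ S e t T
  refine ⟨fun T => (hmT T).comp_aemeasurable hid.aemeasurable_fst, aemeasurable_id, ?_⟩
  have hchi : (multivariateGaussian 0 S).map ((fun x => x.ofLp ⬝ᵥ S⁻¹ *ᵥ x.ofLp) ∘ id)
      = (chiSquared I).map id := by
    rw [Function.comp_id, Measure.map_id,
      multivariateGaussian_map_quadratic (posSemidef_longRunCov ρ) hinv]
  have hlim := hcm.tendsto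
  simp only [← hmapT] at hlim
  exact hlim.trans (le_of_eq (congrArg 𝓝 (Subtype.ext hchi)))
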